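/- Let $n\ge 3$, $2\le m\le n-1$, and write $x=(y;z)\in\mathbb R^n=\mathbb R^m\times\mathbb R^{n-m}$, $\mathcal P=\{x\in\mathbb R^n:\ y=0\}$. Let $1\le p<\infty$, $0\le\sigma\le\min\{1,\frac np\}$, and put $p^*_\sigma=\frac{np}{n-\sigma p}$ ($p^*_\sigma=\infty$ if $\sigma p=n$). For a domain (nonempty connected open set) $\Omega\subset\mathbb R^n$ let $\dot W^1_p(\Omega)$ be the closure of $\mathcal C_0^\infty(\Omega)$ with respect to the norm $\|\nabla v\|_{p,\Omega}$, realized as a space of functions: it consists of the $v\in L_{1,\mathrm{loc}}(\Omega)$ with weak gradient $\nabla v\in L_p(\Omega)$ for which there are $\varphi_k\in\mathcal C_0^\infty(\Omega)$ with $\nabla\varphi_k\to\nabla v$ in $L_p(\Omega)$ and $\varphi_k\to v$ in $L_{1,\mathrm{loc}}(\Omega)$. Suppose that one of the following holds: (a) $\Omega$ is any domain in $\mathbb R^n$ and $\frac{n(p-m)}{p(n-m)}<\sigma\le 1$; (b) $\Omega\subset\mathbb R^n\setminus\mathcal P$, $p>m$, $\sigma\le\min\{\frac{n(p-m)}{p(n-m)},\frac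 np\}$ and $\sigma\ne 1$; (c) $\Omega\subset\mathbb R^n\setminus(\ell\times\mathbb R^{n-m})$ for some ray $\ell\subset\mathbb R^m$ beginning at the origin, $p=m$ and $\sigma=0$. Then there is a finite constant $\mathcal N=\mathcal N(p,\sigma,\Omega)$ such that for every $v\in\dot W^1_p(\Omega)$ $$\big\||y|^{\sigma-1}v\big\|_{p^*_\sigma,\Omega}\le\mathcal N\,\|\nabla v\|_{p,\Omega}.$$ -/

import Mathlib

open MeasureTheory Filter Topology Set
open scoped ENNReal NNReal ContDiff Gradient

namespace MazyaSobolev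

/-- The component `y ∈ ℝᵐ` of a point `x = (y; z) ∈ ℝⁿ = ℝᵐ × ℝⁿ⁻ᵐ`: its first `m` coordinates. -/
def yPart {m n : ℕ} (h : m ≤ n) (x : EuclideanSpace ℝ (Fin n)) : EuclideanSpace ℝ (Fin m) :=
  WithLp.toLp 2 (fun i => x (Fin.castLE h i))

/-- The subspace `𝒫 = {x ∈ ℝⁿ : y = 0}`. -/
def planeP {m n : ℕ} (h : m ≤ n) : Set (EuclideanSpace ℝ (Fin n)) :=
  {x | yPart h x = 0}

/-- The closed ray in `ℝᵐ` that starts at the origin and has direction `e`. -/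
def ray {m : ℕ} (e : EuclideanSpace ℝ (Fin m)) : Set (EuclideanSpace ℝ (Fin m)) :=
  {y | ∃ t : ℝ, 0 ≤ t ∧ y = t • e}

/-- A domain in `ℝⁿ`: a nonempty connected open set. -/
def IsDomainSet {n : ℕ} (Ω : Set (EuclideanSpace ℝ (Fin n))) : Prop :=
  IsOpen Ω ∧ IsConnected Ω

/-- `φ ∈ C₀^∞(Ω)`: a smooth real function on `ℝⁿ` with compact support contained in `Ω`. -/
def IsTestFunction {n : ℕ} (Ω : Set (EuclideanSpace ℝ (Fin n)))
    (φ : EuclideanSpace ℝ (Fin n) → ℝ) : Prop :=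
  ContDiff ℝ ∞ φ ∧ HasCompactSupport φ ∧ tsupport φ ⊆ Ω

/-- `G` is the weak gradient of `v` in `Ω` (both locally integrable in `Ω`):
`∫_Ω v ∇φ = - ∫_Ω φ G` for all `φ ∈ C₀^∞(Ω)`. -/
def HasWeakGradient {n : ℕ} (Ω : Set (EuclideanSpace ℝ (Fin n)))
    (v : EuclideanSpace ℝ (Fin n) → ℝ)
    (G : EuclideanSpace ℝ (Fin n) → EuclideanSpace ℝ (Fin n)) : Prop :=
  LocallyIntegrableOn v Ω volume ∧ LocallyIntegrableOn G Ω volume ∧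
    ∀ φ : EuclideanSpace ℝ (Fin n) → ℝ, IsTestFunction Ω φ →
      ∫ x in Ω, v x • ∇ φ x = - ∫ x in Ω, φ x • G x

/-- `v ∈ Ẇ¹ₚ(Ω)`, the closure of `C₀^∞(Ω)` in the norm `‖∇v‖_{p,Ω}`, realized as a space of
functions: `v` has a weak gradient `G ∈ Lₚ(Ω)`, and there are `φₖ ∈ C₀^∞(Ω)` with `∇φₖ → G` in
`Lₚ(Ω)`. The convergence `φₖ → v` in `L₁` on compact subsets of `Ω` selects the function
represented by the sequence; the gradients alone determine it only up to an additive constant.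
Values of `v` outside `Ω` and on null sets are irrelevant. -/
def MemHomSobolev {n : ℕ} (Ω : Set (EuclideanSpace ℝ (Fin n))) (p : ℝ)
    (v : EuclideanSpace ℝ (Fin n) → ℝ) : Prop :=
  ∃ G : EuclideanSpace ℝ (Fin n) → EuclideanSpace ℝ (Fin n),
    HasWeakGradient Ω v G ∧ MemLp G (ENNReal.ofReal p) (volume.restrict Ω) ∧
    ∃ φ : ℕ → EuclideanSpace ℝ (Fin n) → ℝ,
      (∀ k, IsTestFunction Ω (φ k)) ∧
      Tendsto (fun k => eLpNorm (fun x => ∇ (φ k) x - G x) (ENNReal.ofReal p)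
        (volume.restrict Ω)) atTop (𝓝 0) ∧
      ∀ K : Set (EuclideanSpace ℝ (Fin n)), IsCompact K → K ⊆ Ω →
        Tendsto (fun k => eLpNorm (fun x => φ k x - v x) 1 (volume.restrict K)) atTop (𝓝 0)

/-- The exponent `p*_σ = np / (n - σp)`, equal to `∞` when `σp = n`. -/
noncomputable def pStar (n : ℕ) (p σ : ℝ) : ℝ≥0∞ :=
  if σ * p = n then ∞ else ENNReal.ofReal (n * p / (n - σ * p))

end MazyaSobolev

/-! Let P be the orthogonal projection x ↦ (y; 0). By homogeneity and a closure argument it suffices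
to bound ∫ |y|^(-a) |v|^q, with q = p*_σ and a = n + q(1 - n/p) = (1 - σ)q, over test functions v
with ∫ |∇v|^p ≤ 1. If σp = n the bound is a supremum bound, and it follows from Morrey's inequality.

The basic tool is an L₁ Hardy inequality (`lintegral_weight_le_of_dilation`): write u(x) as an
integral of its derivative along the orbit of the dilations y ↦ ty, and change variables. The
constant is ∫ t^(a-1-k) dt, with k the rank of the projection. It is finite over (1, ∞) when a < k,
where compact support ends the orbit, and over (0, 1) when a > k, where the orbit ends at y = 0 and
v must vanish there. With u = ±|v|^q and Young's inequality, the right side is at most a small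
multiple of the same kind of integral, with exponent s = (q - 1)p', plus a constant. Since the
integrand is |y|^(-n) f^q with f = |y|^(n/p-1)|v|, exponents interpolate pointwise, and the small
term can be absorbed once the left side is known to be finite.

Case (a): the hypothesis on σ says exactly a < m, and it forces p < n. For q ≤ p(n-1)/(n-p), s lies
between q and the Sobolev exponent, so Hardy and Sobolev close the estimate; larger q follow by
interpolation (`exists_lintegral_weightedPower_le`).

Case (b): v vanishes near the plane and p > m, so Hardy on (0, 1) applies with q = s = p. The
exponent is then raised to q by Sobolev's inequality if p < n, by Morrey's if p > n, and by
iterating the L₁ Sobolev inequality for |y|^(1-n)|v|^γ if p = n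
(`exists_lintegral_weightedPower_le_of_vanishing`).

Case (c): here p = m is critical for P. Removing the direction e of the ray leaves a projection of
rank m - 1 < p, and on the half-space ⟨e, x⟩ ≥ 0 its kernel is the slit, where v vanishes. This
controls that half-space; the other one is reached by rotating it through the angle π and
integrating the derivative along the rotation (`exists_lintegral_weightedPower_le_of_slit`). -/

namespace MazyaSobolev

/-! ### Integration along curves and dilation orbits -/

section Curves

variable {E : Type*} [NormedAddCommGroup E] [InnerProductSpace ℝ E]

/-- The fundamental theorem of calculus along a curve. -/
theorem enorm_sub_le_lintegral_fderiv {u : E → ℝ} (hu : ContDiff ℝ 1 u) {γ γ' : ℝ → E}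
    (hγ : ∀ t, HasDerivAt γ (γ' t) t) (hγ' : Continuous γ') {a b : ℝ} (hab : a ≤ b) :
    ‖u (γ b) - u (γ a)‖ₑ ≤ ∫⁻ t in Icc a b, ‖γ' t‖ₑ * ‖fderiv ℝ u (γ t)‖ₑ := by
  have hγd : ContDiff ℝ 1 γ := by
    rw [contDiff_one_iff_deriv]
    refine ⟨fun t => (hγ t).differentiableAt, ?_⟩
    rwa [funext fun t => (hγ t).deriv]
  have hc : ContDiff ℝ 1 (u ∘ γ) := hu.comp hγd
  refine (enorm_sub_le_lintegral_deriv_of_contDiffOn_Icc hc.contDiffOn hab).trans ?_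
  refine lintegral_mono fun t => ?_
  have := ((hu.differentiable one_ne_zero (γ t)).hasFDerivAt.comp_hasDerivAt t (hγ t)).deriv
  rw [this, mul_comm]
  exact ContinuousLinearMap.le_opENorm _ _

theorem enorm_sub_le_lintegral_dilation (P : E →L[ℝ] E) {u : E → ℝ} (hu : ContDiff ℝ 1 u)
    (x : E) {a b : ℝ} (hab : a ≤ b) :
    ‖u (x + (b - 1) • P x) - u (x + (a - 1) • P x)‖ₑ ≤
      ∫⁻ t in Ioo a b, ‖P x‖ₑ * ‖fderiv ℝ u (x + (t - 1) • P x)‖ₑ := by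
  have := enorm_sub_le_lintegral_fderiv hu (γ := fun t => x + (t - 1) • P x)
    (γ' := fun _ => P x) (fun t => by
      simpa using (((hasDerivAt_id t).sub_const 1).smul_const (P x)).const_add x)
    continuous_const hab
  rwa [setLIntegral_congr (Ioo_ae_eq_Icc (a := a) (b := b)).symm] at this

theorem enorm_le_lintegral_dilation_Ioi (P : E →L[ℝ] E) {u : E → ℝ} (hu : ContDiff ℝ 1 u)
    (hc : HasCompactSupport u) {x : E} (hx : P x ≠ 0) :
    ‖u x‖ₑ ≤ ∫⁻ t in Ioi (1 : ℝ), ‖P x‖ₑ * ‖fderiv ℝ u (x + (t - 1) • P x)‖ₑ := by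
  obtain ⟨R, hR⟩ := hc.isCompact.isBounded.exists_norm_le
  have hPx : 0 < ‖P x‖ := norm_pos_iff.2 hx
  -- Chosen so that (T - 1)‖P x‖ = |R| + ‖x‖ + 1: the orbit has left the ball of radius R that
  -- contains the support.
  set T : ℝ := 1 + (|R| + ‖x‖ + 1) / ‖P x‖ with hT
  have hT1 : 1 ≤ T := by rw [hT]; linarith [show 0 ≤ (|R| + ‖x‖ + 1) / ‖P x‖ by positivity]
  have h0 : u (x + (T - 1) • P x) = 0 := by
    by_contra hne
    have h1 := hR _ (subset_tsupport _ (Function.mem_support.2 hne))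
    have h2 : ‖(T - 1) • P x‖ = |R| + ‖x‖ + 1 := by
      rw [norm_smul, Real.norm_of_nonneg (by linarith), hT]; field_simp; ring
    have h3 := norm_sub_le_norm_add ((T - 1) • P x) x
    rw [add_comm] at h3
    linarith [le_abs_self R]
  have h := enorm_sub_le_lintegral_dilation P hu x hT1
  rw [h0] at h
  simp only [sub_self, zero_smul, add_zero, zero_sub, enorm_neg] at h
  exact h.trans (lintegral_mono_set Ioo_subset_Ioi_self)

theorem enorm_le_lintegral_dilation_Ioo (P : E →L[ℝ] E) {u : E → ℝ} (hu : ContDiff ℝ 1 u)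
    {x : E} (hx : u (x - P x) = 0) :
    ‖u x‖ₑ ≤ ∫⁻ t in Ioo (0 : ℝ) 1, ‖P x‖ₑ * ‖fderiv ℝ u (x + (t - 1) • P x)‖ₑ := by
  have h := enorm_sub_le_lintegral_dilation P hu x zero_le_one
  simpa [hx, ← sub_eq_add_neg] using h

end Curves

/-! ### Dilations along the range of a projection, and the L₁ Hardy inequality -/

section Dilation

variable {E : Type*} [NormedAddCommGroup E] [InnerProductSpace ℝ E] [FiniteDimensional ℝ E]

/-- Scaling by `t` along the range of a projection has determinant `t ^ rank`. -/
theorem det_dilation {P : E →L[ℝ] E} (hP : ∀ x, P (P x) = P x) (t : ℝ) :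
    LinearMap.det (LinearMap.id + (t - 1) • (P : E →ₗ[ℝ] E)) =
      t ^ Module.finrank ℝ (LinearMap.range (P : E →ₗ[ℝ] E)) := by
  set p := LinearMap.range (P : E →ₗ[ℝ] E) with hp
  have h : LinearMap.IsProj p (P : E →ₗ[ℝ] E) :=
    ⟨fun x => ⟨x, rfl⟩, by rintro _ ⟨y, rfl⟩; exact hP y⟩
  set e := p.prodEquivOfIsCompl _ h.isCompl with he
  have key : LinearMap.id + (t - 1) • (P : E →ₗ[ℝ] E) =
      e.conj (LinearMap.prodMap (t • LinearMap.id) LinearMap.id) := by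
    have h1 : (P : E →ₗ[ℝ] E) = e.conj (LinearMap.prodMap LinearMap.id 0) := h.eq_conj_prodMap
    have h2 : (LinearMap.id : E →ₗ[ℝ] E) = e.conj LinearMap.id := by simp
    have h3 : LinearMap.prodMap (t • LinearMap.id) LinearMap.id =
        (LinearMap.id : (p × LinearMap.ker (P : E →ₗ[ℝ] E)) →ₗ[ℝ] _) +
          (t - 1) • LinearMap.prodMap LinearMap.id 0 := by
      apply LinearMap.ext
      rintro ⟨x, y⟩
      refine Prod.ext ?_ ?_
      · simp; module
      · simp
    rw [h3, map_add, map_smul, ← h1, ← h2]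
  rw [key, LinearEquiv.conj_apply, LinearMap.comp_assoc, LinearMap.det_conj, LinearMap.det_prodMap, LinearMap.det_smul]
  simp

variable [MeasurableSpace E] [BorelSpace E]

/-- Change of variables for a linear map whose determinant is t ^ k. -/
theorem lintegral_comp_dilation {P : E →L[ℝ] E} (hP : ∀ x, P (P x) = P x) {k : ℕ}
    (hk : Module.finrank ℝ (LinearMap.range (P : E →ₗ[ℝ] E)) = k) {t : ℝ} (ht : 0 < t)
    {F : E → ℝ≥0∞} (hF : Measurable F) :
    ∫⁻ x, F (x + (t - 1) • P x) = ENNReal.ofReal (t ^ (-(k : ℝ))) * ∫⁻ x, F x := by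
  set T : E →ₗ[ℝ] E := LinearMap.id + (t - 1) • (P : E →ₗ[ℝ] E) with hT
  have hdet : LinearMap.det T = t ^ k := by rw [hT, det_dilation hP, hk]
  have hmap := Measure.map_linearMap_addHaar_eq_smul_addHaar (volume : Measure E) (f := T)
    (by rw [hdet]; positivity)
  have hTm : Measurable T := T.continuous_of_finiteDimensional.measurable
  calc ∫⁻ x, F (x + (t - 1) • P x) = ∫⁻ x, F (T x) := by simp [hT]
    _ = ∫⁻ x, F x ∂(Measure.map T volume) := (lintegral_map hF hTm).symm
    _ = _ := by
      rw [hmap, lintegral_smul_measure, hdet, Real.rpow_neg ht.le, Real.rpow_natCast,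
        abs_of_pos (by positivity), smul_eq_mul]

/-- The weighted `L₁` Hardy inequality along the orbits of a dilation group. -/
theorem lintegral_weight_le_of_dilation {P : E →L[ℝ] E} (hP : ∀ x, P (P x) = P x) {k : ℕ}
    (hk : Module.finrank ℝ (LinearMap.range (P : E →ₗ[ℝ] E)) = k) {J : Set ℝ}
    (hJm : MeasurableSet J) (hJ : J ⊆ Ioi 0) {a : ℝ} {W : E → ℝ≥0∞} (hW : Measurable W)
    (hWJ : ∀ x, ∀ t ∈ J, W x ≤ ENNReal.ofReal (t ^ a) * W (x + (t - 1) • P x))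
    {u : E → ℝ} (hu : ContDiff ℝ 1 u)
    (hpath : ∀ x, W x ≠ 0 →
      ‖u x‖ₑ ≤ ∫⁻ t in J, ‖P x‖ₑ * ‖fderiv ℝ u (x + (t - 1) • P x)‖ₑ) :
    ∫⁻ x, W x * ‖u x‖ₑ ≤ (∫⁻ t in J, ENNReal.ofReal (t ^ (a - 1 - k))) *
      ∫⁻ x, W x * (‖P x‖ₑ * ‖fderiv ℝ u x‖ₑ) := by
  set F : E → ℝ≥0∞ := fun x => W x * (‖P x‖ₑ * ‖fderiv ℝ u x‖ₑ) with hF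
  have hdu : Continuous (fderiv ℝ u) := hu.continuous_fderiv one_ne_zero
  have hFm : Measurable F :=
    hW.mul ((P.continuous.enorm.measurable).mul hdu.enorm.measurable)
  have hD : Continuous fun z : E × ℝ => z.1 + (z.2 - 1) • P z.1 := by fun_prop
  -- The weight costs t ^ a when moved along the orbit, and ‖P x‖ = t⁻¹ ‖P (x + (t - 1) • P x)‖
  -- gives back one power. The Jacobian below contributes t ^ (-k).
  have step : ∀ x, W x * ‖u x‖ₑ ≤
      ∫⁻ t in J, ENNReal.ofReal (t ^ (a - 1)) * F (x + (t - 1) • P x) := by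
    intro x
    by_cases h0 : W x = 0
    · simp [h0]
    calc W x * ‖u x‖ₑ
        ≤ W x * ∫⁻ t in J, ‖P x‖ₑ * ‖fderiv ℝ u (x + (t - 1) • P x)‖ₑ := by
          gcongr; exact hpath x h0
      _ ≤ ∫⁻ t in J, W x * (‖P x‖ₑ * ‖fderiv ℝ u (x + (t - 1) • P x)‖ₑ) := by
          apply lintegral_const_mul_le
      _ ≤ _ := by
          refine setLIntegral_mono' hJm fun t ht => ?_
          have ht0 : 0 < t := hJ ht
          have hPt : P (x + (t - 1) • P x) = t • P x := by
            rw [map_add, map_smul, hP]; module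
          have h1 : ENNReal.ofReal (t ^ (a - 1)) * ‖t • P x‖ₑ =
              ENNReal.ofReal (t ^ a) * ‖P x‖ₑ := by
            rw [enorm_smul, ← mul_assoc, Real.enorm_eq_ofReal ht0.le,
              ← ENNReal.ofReal_mul (by positivity), ← Real.rpow_add_one ht0.ne']
            simp
          simp only [hF, hPt]
          calc W x * (‖P x‖ₑ * ‖fderiv ℝ u (x + (t - 1) • P x)‖ₑ)
              ≤ (ENNReal.ofReal (t ^ a) * W (x + (t - 1) • P x)) *
                (‖P x‖ₑ * ‖fderiv ℝ u (x + (t - 1) • P x)‖ₑ) := by gcongr; exact hWJ x t ht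
            _ = W (x + (t - 1) • P x) * (ENNReal.ofReal (t ^ a) * ‖P x‖ₑ) *
                ‖fderiv ℝ u (x + (t - 1) • P x)‖ₑ := by ring
            _ = _ := by rw [← h1]; ring
            _ ≤ _ := le_rfl
  calc ∫⁻ x, W x * ‖u x‖ₑ
      ≤ ∫⁻ x, ∫⁻ t in J, ENNReal.ofReal (t ^ (a - 1)) * F (x + (t - 1) • P x) :=
        lintegral_mono step
    _ = ∫⁻ t in J, ∫⁻ x, ENNReal.ofReal (t ^ (a - 1)) * F (x + (t - 1) • P x) := by
        refine lintegral_lintegral_swap (Measurable.aemeasurable ?_)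
        have := hFm.comp hD.measurable
        exact (((measurable_snd (α := E) (β := ℝ)).pow_const (a - 1)).ennreal_ofReal).mul this
    _ = ∫⁻ t in J, ENNReal.ofReal (t ^ (a - 1 - k)) * ∫⁻ x, F x := by
        refine setLIntegral_congr_fun hJm fun t ht => ?_
        have ht0 : 0 < t := hJ ht
        have hDt : Continuous fun x : E => x + (t - 1) • P x := by fun_prop
        rw [lintegral_const_mul _ (f := fun x => F (x + (t - 1) • P x)) (hFm.comp hDt.measurable),
          lintegral_comp_dilation hP hk ht0 hFm,
          ← mul_assoc, ← ENNReal.ofReal_mul (by positivity), ← Real.rpow_add ht0]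
        congr 3
    _ = _ := by
        rw [lintegral_mul_const]
        exact (measurable_id.pow_const _).ennreal_ofReal

theorem lintegral_Ioi_rpow_lt_top {s : ℝ} (hs : s < -1) :
    ∫⁻ t in Ioi (1 : ℝ), ENNReal.ofReal (t ^ s) < ⊤ :=
  (integrableOn_Ioi_rpow_of_lt hs one_pos).lintegral_lt_top

theorem lintegral_Ioo_rpow_lt_top {s : ℝ} (hs : -1 < s) :
    ∫⁻ t in Ioo (0 : ℝ) 1, ENNReal.ofReal (t ^ s) < ⊤ :=
  ((intervalIntegral.integrableOn_Ioo_rpow_iff one_pos).2 hs).lintegral_lt_top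

end Dilation

/-! ### Young's inequality with a small parameter, and absorption -/

theorem exists_mul_le_rpow_add_rpow {p p' : ℝ} (hpp : p'.HolderConjugate p) {ε : ℝ} (hε : 0 < ε) :
    ∃ C : ℝ, 0 < C ∧ ∀ α β : ℝ, 0 ≤ α → 0 ≤ β → α * β ≤ ε * α ^ p' + C * β ^ p := by
  set η : ℝ := ε ^ p'⁻¹ with hη
  have hη0 : 0 < η := by positivity
  refine ⟨η⁻¹ ^ p, by positivity, fun α β hα hβ => ?_⟩
  have h := Real.young_inequality_of_nonneg (a := η * α) (b := η⁻¹ * β)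
    (by positivity) (by positivity) hpp
  have h1 : η * α * (η⁻¹ * β) = α * β := by field_simp
  rw [h1, Real.mul_rpow hη0.le hα, Real.mul_rpow (by positivity) hβ] at h
  have h2 : η ^ p' = ε := by
    rw [hη, ← Real.rpow_mul hε.le, inv_mul_cancel₀ hpp.pos.ne', Real.rpow_one]
  rw [h2] at h
  have h3 : ε * α ^ p' / p' ≤ ε * α ^ p' :=
    div_le_self (by positivity) hpp.lt.le
  have h4 : η⁻¹ ^ p * β ^ p / p ≤ η⁻¹ ^ p * β ^ p :=
    div_le_self (by positivity) hpp.symm.lt.le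
  linarith

theorem le_two_mul_of_le_half_add {X C : ℝ≥0∞} (hX : X ≠ ⊤) (h : X ≤ 2⁻¹ * X + C) :
    X ≤ 2 * C := by
  by_cases hC : C = ⊤
  · simp [hC]
  lift X to ℝ≥0 using hX
  lift C to ℝ≥0 using hC
  have e : (2⁻¹ : ℝ≥0∞) = ((2⁻¹ : ℝ≥0) : ℝ≥0∞) := by simp
  rw [e] at h
  norm_cast at h ⊢
  rw [← NNReal.coe_le_coe] at h ⊢
  push_cast at h ⊢
  linarith

/-! ### The scale-invariant integrand -/

section

variable {E : Type*} [NormedAddCommGroup E] [InnerProductSpace ℝ E]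

/-- For q > 1 the function |v|^q is itself C¹. For q = 1 it need not be, and v takes its place; only
the absolute value of u matters later. -/
theorem exists_contDiff_abs_rpow {v : E → ℝ} (hv : ContDiff ℝ 1 v) {q : ℝ} (hq : 1 ≤ q) :
    ∃ u : E → ℝ, ContDiff ℝ 1 u ∧ (∀ x, |u x| = |v x| ^ q) ∧
      ∀ x, ‖fderiv ℝ u x‖ ≤ q * (|v x| ^ (q - 1) * ‖fderiv ℝ v x‖) := by
  rcases hq.eq_or_lt with rfl | hq
  · exact ⟨v, hv, by simp, by simp⟩
  · refine ⟨fun x => ‖v x‖ ^ q, hv.norm_rpow hq, fun x => ?_, fun x => ?_⟩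
    · simp only [Real.norm_eq_abs]
      exact abs_of_nonneg (by positivity)
    · rw [← mul_assoc]
      exact norm_fderiv_norm_rpow_le (hv.differentiable one_ne_zero) hq

/-- The integrand `|y|^(-n - q(1 - n/p)) |v|^q`, with `y = P x`. The power of the weight makes its
integral and the `q/p`-th power of `∫ |∇v|^p` scale alike. -/
noncomputable def weightedPower (P : E →L[ℝ] E) (n p q : ℝ) (v : E → ℝ) (x : E) : ℝ :=
  ‖P x‖ ^ (-(n + q * (1 - n / p))) * |v x| ^ q

theorem weightedPower_nonneg (P : E →L[ℝ] E) (n p q : ℝ) (v : E → ℝ) (x : E) :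
    0 ≤ weightedPower P n p q v x := by
  unfold weightedPower; positivity

theorem weightedPower_eq (P : E →L[ℝ] E) (n p q : ℝ) (v : E → ℝ) {x : E} (hx : P x ≠ 0) :
    weightedPower P n p q v x = ‖P x‖ ^ (-n) * (‖P x‖ ^ (-(1 - n / p)) * |v x|) ^ q := by
  have h := norm_pos_iff.2 hx
  rw [weightedPower, Real.mul_rpow (by positivity) (abs_nonneg _), ← Real.rpow_mul h.le,
    ← mul_assoc, ← Real.rpow_add h]
  ring_nf

/-- By `weightedPower_eq` the exponent enters only through f ^ q, and f ^ q ≤ f ^ q₀ + f ^ q₁,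
according to whether f ≤ 1 or f ≥ 1. -/
theorem weightedPower_le_add (P : E →L[ℝ] E) (n p : ℝ) {q₀ q q₁ : ℝ} (hq₀ : 0 < q₀)
    (h₀ : q₀ ≤ q) (h₁ : q ≤ q₁) (v : E → ℝ) {x : E} (hx : P x ≠ 0) :
    weightedPower P n p q v x ≤ weightedPower P n p q₀ v x + weightedPower P n p q₁ v x := by
  simp only [weightedPower_eq P n p _ v hx, ← mul_add]
  gcongr
  set f := ‖P x‖ ^ (-(1 - n / p)) * |v x|
  have hf : 0 ≤ f := by positivity
  rcases le_total f 1 with h | h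
  · have := Real.rpow_le_rpow_of_exponent_ge_of_imp hf h h₀ (fun _ h => absurd h (hq₀.trans_le h₀).ne')
    have : 0 ≤ f ^ q₁ := by positivity
    linarith
  · have := Real.rpow_le_rpow_of_exponent_le h h₁
    have : 0 ≤ f ^ q₀ := by positivity
    linarith

theorem measurable_weightedPower [MeasurableSpace E] [BorelSpace E]
    (P : E →L[ℝ] E) (n p q : ℝ) {v : E → ℝ} (hv : Continuous v) :
    Measurable (weightedPower P n p q v) := by
  unfold weightedPower
  exact (P.continuous.norm.measurable.pow_const _).mul (hv.abs.measurable.pow_const _)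

/-- Young's inequality with |∇v| as one factor. The p'-th power of the other factor is again a
scale-invariant integrand, with exponent (q - 1)p', because the weight exponents match. -/
theorem exists_hardy_integrand_le (n : ℝ) {p p' : ℝ} (hpp : p'.HolderConjugate p) (q : ℝ)
    {ε : ℝ} (hε : 0 < ε) : ∃ C : ℝ, 0 < C ∧ ∀ (P : E →L[ℝ] E) (v : E → ℝ) (x : E), P x ≠ 0 →
      ‖P x‖ ^ (1 - (n + q * (1 - n / p))) * (|v x| ^ (q - 1) * ‖fderiv ℝ v x‖) ≤
        ε * weightedPower P n p ((q - 1) * p') v x + C * ‖fderiv ℝ v x‖ ^ p := by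
  obtain ⟨C, hC, h⟩ := exists_mul_le_rpow_add_rpow hpp hε
  refine ⟨C, hC, fun P v x hx => ?_⟩
  have hy := norm_pos_iff.2 hx
  rw [← mul_assoc]
  refine (h _ _ (by positivity) (norm_nonneg _)).trans_eq ?_
  congr 2
  rw [weightedPower, Real.mul_rpow (by positivity) (by positivity), ← Real.rpow_mul hy.le,
    ← Real.rpow_mul (abs_nonneg _)]
  congr 2
  have h1 := hpp.inv_add_inv_eq_one
  have h2 := hpp.pos
  have h3 := hpp.symm.pos
  field_simp at h1 ⊢
  linear_combination n * h1

end

/-! ### Hardy inequality for powers of v, prepared for absorption -/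

section

variable {E : Type*} [NormedAddCommGroup E] [InnerProductSpace ℝ E] [FiniteDimensional ℝ E]
  [MeasurableSpace E] [BorelSpace E]

theorem ae_map_ne_zero {P : E →L[ℝ] E} {k : ℕ}
    (hk : Module.finrank ℝ (LinearMap.range (P : E →ₗ[ℝ] E)) = k) (hk0 : 0 < k) :
    ∀ᵐ x : E, P x ≠ 0 := by
  have h : LinearMap.ker (P : E →ₗ[ℝ] E) ≠ ⊤ := by
    intro h
    rw [LinearMap.ker_eq_top] at h
    rw [h, LinearMap.range_zero, finrank_bot] at hk
    omega
  have := Measure.addHaar_submodule volume _ h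
  rw [ae_iff]
  simp only [not_not]
  exact this

theorem lintegral_weightedPower_le_add {P : E →L[ℝ] E} (hP : ∀ᵐ x : E, P x ≠ 0) (n p : ℝ)
    {q₀ q q₁ : ℝ} (hq₀ : 0 < q₀) (h₀ : q₀ ≤ q) (h₁ : q ≤ q₁) {v : E → ℝ} (hv : Continuous v)
    (S : Set E) :
    ∫⁻ x in S, ENNReal.ofReal (weightedPower P n p q v x) ≤
      (∫⁻ x in S, ENNReal.ofReal (weightedPower P n p q₀ v x)) +
        ∫⁻ x in S, ENNReal.ofReal (weightedPower P n p q₁ v x) := by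
  rw [← lintegral_add_left (measurable_weightedPower P n p q₀ hv).ennreal_ofReal]
  refine lintegral_mono_ae ((ae_restrict_of_ae hP).mono fun x hx => ?_)
  rw [← ENNReal.ofReal_add (weightedPower_nonneg ..) (weightedPower_nonneg ..)]
  exact ENNReal.ofReal_le_ofReal (weightedPower_le_add P n p hq₀ h₀ h₁ v hx)

/-- The `L₁` Hardy inequality for `|v|^q` on a set invariant under the dilations by `t ∈ J`. -/
theorem lintegral_rpow_le_of_dilation {P : E →L[ℝ] E} (hP : ∀ x, P (P x) = P x) {k : ℕ}
    (hk : Module.finrank ℝ (LinearMap.range (P : E →ₗ[ℝ] E)) = k) {J : Set ℝ}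
    (hJm : MeasurableSet J) (hJ : J ⊆ Ioi 0) {S : Set E} (hS : MeasurableSet S)
    (hSJ : ∀ x ∈ S, ∀ t ∈ J, x + (t - 1) • P x ∈ S) (a : ℝ) {q : ℝ} (hq : 1 ≤ q)
    {v : E → ℝ} (hv : ContDiff ℝ 1 v)
    (hpath : ∀ u : E → ℝ, ContDiff ℝ 1 u → (∀ x, |u x| = |v x| ^ q) → ∀ x ∈ S,
      ‖u x‖ₑ ≤ ∫⁻ t in J, ‖P x‖ₑ * ‖fderiv ℝ u (x + (t - 1) • P x)‖ₑ) :
    ∫⁻ x in S, ENNReal.ofReal (‖P x‖ ^ (-a) * |v x| ^ q) ≤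
      (∫⁻ t in J, ENNReal.ofReal (t ^ (a - 1 - k))) *
        (ENNReal.ofReal q * ∫⁻ x in S, ENNReal.ofReal
          (‖P x‖ ^ (1 - a) * (|v x| ^ (q - 1) * ‖fderiv ℝ v x‖))) := by
  obtain ⟨u, hu, huv, hdu⟩ := exists_contDiff_abs_rpow hv hq
  have hq0 : 0 ≤ q := by linarith
  set W : E → ℝ≥0∞ := S.indicator fun x => ENNReal.ofReal (‖P x‖ ^ (-a)) with hW
  have hWm : Measurable W :=
    ((P.continuous.norm.measurable.pow_const _).ennreal_ofReal).indicator hS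
  have main := lintegral_weight_le_of_dilation hP hk hJm hJ (a := a) hWm (u := u) ?_ hu ?_
  · have e1 : ∀ x, W x * ‖u x‖ₑ =
        S.indicator (fun x => ENNReal.ofReal (‖P x‖ ^ (-a) * |v x| ^ q)) x := by
      intro x
      by_cases hx : x ∈ S
      · simp only [hW, indicator_of_mem hx]
        rw [ENNReal.ofReal_mul (by positivity), ← huv, ← Real.enorm_eq_ofReal (abs_nonneg _),
          Real.enorm_abs]
      · simp [hW, hx]
    have e2 : ∀ x, W x * (‖P x‖ₑ * ‖fderiv ℝ u x‖ₑ) ≤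
        S.indicator (fun x => ENNReal.ofReal q * ENNReal.ofReal
          (‖P x‖ ^ (1 - a) * (|v x| ^ (q - 1) * ‖fderiv ℝ v x‖))) x := by
      intro x
      by_cases hx : x ∈ S
      · simp only [hW, indicator_of_mem hx]
        rw [← ofReal_norm, ← ofReal_norm, ← ENNReal.ofReal_mul (by positivity),
          ← ENNReal.ofReal_mul (by positivity), ← ENNReal.ofReal_mul hq0]
        refine ENNReal.ofReal_le_ofReal ?_
        by_cases h0 : ‖P x‖ = 0
        · rw [h0]; simp only [zero_mul, mul_zero]; positivity
        have hy : 0 < ‖P x‖ := lt_of_le_of_ne (norm_nonneg _) (Ne.symm h0)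
        have e3 : ‖P x‖ ^ (1 - a) = ‖P x‖ ^ (-a) * ‖P x‖ := by
          rw [← Real.rpow_add_one h0]; ring_nf
        calc ‖P x‖ ^ (-a) * (‖P x‖ * ‖fderiv ℝ u x‖)
            ≤ ‖P x‖ ^ (-a) * (‖P x‖ * (q * (|v x| ^ (q - 1) * ‖fderiv ℝ v x‖))) := by
              gcongr; exact hdu x
          _ = _ := by rw [e3]; ring
      · simp [hW, hx]
    simp_rw [e1] at main
    rw [lintegral_indicator hS] at main
    refine main.trans ?_
    gcongr
    refine (lintegral_mono e2).trans_eq ?_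
    rw [lintegral_indicator hS, lintegral_const_mul' _ _ ENNReal.ofReal_ne_top]
  · intro x t ht
    by_cases hx : x ∈ S
    · have ht0 : 0 < t := hJ ht
      have hPt : P (x + (t - 1) • P x) = t • P x := by
        rw [map_add, map_smul, hP]; module
      simp only [hW, indicator_of_mem hx, indicator_of_mem (hSJ x hx t ht), hPt]
      rw [norm_smul, Real.norm_of_nonneg ht0.le, Real.mul_rpow ht0.le (norm_nonneg _),
        ← ENNReal.ofReal_mul (by positivity), ← mul_assoc, ← Real.rpow_add ht0]
      simp
    · simp [hW, hx]
  · intro x hx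
    refine hpath u hu huv x ?_
    by_contra hxS
    exact hx (by simp [hW, hxS])

/-- The form of the Hardy inequality that is fit for absorption. -/
theorem exists_lintegral_weightedPower_le_quarter (n : ℝ) {p p' : ℝ}
    (hpp : p'.HolderConjugate p) (q : ℝ) (K : ℝ≥0) :
    ∃ C : ℝ≥0, ∀ (P : E →L[ℝ] E) (S : Set E) (v : E → ℝ), (∀ᵐ x : E, P x ≠ 0) → ContDiff ℝ 1 v →
      ∫⁻ x, ENNReal.ofReal (‖fderiv ℝ v x‖ ^ p) ≤ 1 →
      K * ∫⁻ x in S, ENNReal.ofReal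
          (‖P x‖ ^ (1 - (n + q * (1 - n / p))) * (|v x| ^ (q - 1) * ‖fderiv ℝ v x‖)) ≤
        4⁻¹ * (∫⁻ x in S, ENNReal.ofReal (weightedPower P n p ((q - 1) * p') v x)) + C := by
  -- K + 1 instead of K keeps the choice meaningful when K = 0; all that is needed is Kε ≤ 1/4.
  have hε : 0 < 4⁻¹ * ((K : ℝ) + 1)⁻¹ := by positivity
  obtain ⟨C, hC, h⟩ := exists_hardy_integrand_le (E := E) n hpp q hε
  refine ⟨K * C.toNNReal, fun P S v hP hv h1 => ?_⟩
  have hdm : Measurable fun x => ‖fderiv ℝ v x‖ :=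
    (hv.continuous_fderiv one_ne_zero).norm.measurable
  set s := (q - 1) * p'
  have key : ∫⁻ x in S, ENNReal.ofReal
      (‖P x‖ ^ (1 - (n + q * (1 - n / p))) * (|v x| ^ (q - 1) * ‖fderiv ℝ v x‖)) ≤
      ENNReal.ofReal (4⁻¹ * ((K : ℝ) + 1)⁻¹) *
        (∫⁻ x in S, ENNReal.ofReal (weightedPower P n p s v x)) + ENNReal.ofReal C := by
    calc _ ≤ ∫⁻ x in S, (ENNReal.ofReal (4⁻¹ * ((K : ℝ) + 1)⁻¹) *
          ENNReal.ofReal (weightedPower P n p s v x) +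
          ENNReal.ofReal C * ENNReal.ofReal (‖fderiv ℝ v x‖ ^ p)) := by
          refine lintegral_mono_ae ((ae_restrict_of_ae hP).mono fun x hx => ?_)
          rw [← ENNReal.ofReal_mul hε.le, ← ENNReal.ofReal_mul hC.le,
            ← ENNReal.ofReal_add (mul_nonneg hε.le (weightedPower_nonneg ..)) (by positivity)]
          exact ENNReal.ofReal_le_ofReal (h P v x hx)
      _ = ENNReal.ofReal (4⁻¹ * ((K : ℝ) + 1)⁻¹) *
          (∫⁻ x in S, ENNReal.ofReal (weightedPower P n p s v x)) +
          ENNReal.ofReal C * ∫⁻ x in S, ENNReal.ofReal (‖fderiv ℝ v x‖ ^ p) := by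
          rw [lintegral_add_right _ ((hdm.pow_const _).ennreal_ofReal.const_mul _),
            lintegral_const_mul' _ _ ENNReal.ofReal_ne_top,
            lintegral_const_mul' _ _ ENNReal.ofReal_ne_top]
      _ ≤ _ := by
          gcongr
          calc _ ≤ ENNReal.ofReal C * 1 := by
                gcongr
                exact (setLIntegral_le_lintegral _ _).trans h1
            _ = _ := mul_one _
  calc _ ≤ (K : ℝ≥0∞) * (ENNReal.ofReal (4⁻¹ * ((K : ℝ) + 1)⁻¹) *
        (∫⁻ x in S, ENNReal.ofReal (weightedPower P n p s v x)) + ENNReal.ofReal C) := by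
        gcongr
    _ = (K * ENNReal.ofReal (4⁻¹ * ((K : ℝ) + 1)⁻¹)) *
        (∫⁻ x in S, ENNReal.ofReal (weightedPower P n p s v x)) + K * ENNReal.ofReal C := by ring
    _ ≤ _ := by
        gcongr
        · have : (K : ℝ≥0∞) = ENNReal.ofReal (K : ℝ) := by simp
          rw [this, ← ENNReal.ofReal_mul (by positivity)]
          have h4 : (4⁻¹ : ℝ≥0∞) = ENNReal.ofReal 4⁻¹ := by
            rw [ENNReal.ofReal_inv_of_pos (by norm_num)]; simp
          rw [h4]
          apply ENNReal.ofReal_le_ofReal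
          have : (K : ℝ) * ((K : ℝ) + 1)⁻¹ ≤ 1 := by
            rw [← div_eq_mul_inv, div_le_one (by positivity)]; linarith
          linarith
        · push_cast
          rfl

end

theorem lintegral_ofReal_norm_rpow {α F : Type*} [MeasurableSpace α] [NormedAddCommGroup F]
    (μ : Measure α) (f : α → F) {p : ℝ} (hp : 0 < p) :
    ∫⁻ x, ENNReal.ofReal (‖f x‖ ^ p) ∂μ = eLpNorm f (ENNReal.ofReal p) μ ^ p := by
  rw [eLpNorm_eq_lintegral_rpow_enorm_toReal (by simpa using hp) ENNReal.ofReal_ne_top,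
    ENNReal.toReal_ofReal hp.le, ← ENNReal.rpow_mul, one_div, inv_mul_cancel₀ hp.ne',
    ENNReal.rpow_one]
  congr 1
  ext x
  rw [← ENNReal.ofReal_rpow_of_nonneg (norm_nonneg _) hp.le, ofReal_norm]

/-! ### The Sobolev endpoint and locally integrable weights: case (a) -/

section

variable {E : Type*} [NormedAddCommGroup E] [InnerProductSpace ℝ E] [FiniteDimensional ℝ E]
  [MeasurableSpace E] [BorelSpace E]

/-- Supplies the finiteness without which absorption is void. Replacing ‖P x‖ by max d ‖P x‖ changes
nothing where v ≠ 0 on S and makes the integrand continuous with compact support. -/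
theorem lintegral_weightedPower_lt_top (P : E →L[ℝ] E) (n p : ℝ) {q : ℝ} (hq : 0 < q)
    {v : E → ℝ} (hv : Continuous v) (hc : HasCompactSupport v) {S : Set E} (hS : MeasurableSet S)
    {d : ℝ} (hd : 0 < d) (h : ∀ x ∈ S, v x ≠ 0 → d ≤ ‖P x‖) :
    ∫⁻ x in S, ENNReal.ofReal (weightedPower P n p q v x) < ⊤ := by
  set g : E → ℝ := fun x => max d ‖P x‖ ^ (-(n + q * (1 - n / p))) * |v x| ^ q with hg
  have hgc : Continuous g := by
    refine Continuous.mul ?_ (hv.abs.rpow_const fun _ => Or.inr hq.le)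
    refine (continuous_const.max P.continuous.norm).rpow_const fun x => Or.inl ?_
    exact (lt_max_of_lt_left hd).ne'
  have hgs : HasCompactSupport g := by
    refine hc.mono fun x hx => ?_
    rw [Function.mem_support] at hx ⊢
    contrapose! hx
    simp [hg, hx, hq.ne']
  refine lt_of_le_of_lt ?_ (hgc.integrable_of_hasCompactSupport (μ := volume) hgs).lintegral_lt_top
  refine (setLIntegral_mono' hS fun x hx => ?_).trans (setLIntegral_le_lintegral S _)
  refine ENNReal.ofReal_le_ofReal ?_
  by_cases h0 : v x = 0
  · simp [weightedPower, hg, h0, hq.ne']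
  · simp only [hg, weightedPower, max_eq_right (h x hx h0), le_refl]

/-- At this exponent the weight is trivial, and the claim is the Gagliardo–Nirenberg–Sobolev
inequality. -/
theorem exists_lintegral_weightedPower_le_of_sobolev (P : E →L[ℝ] E) {p : ℝ} (hp : 1 ≤ p)
    (hpn : p < Module.finrank ℝ E) :
    ∃ C : ℝ≥0, ∀ v : E → ℝ, ContDiff ℝ 1 v → HasCompactSupport v →
      ∫⁻ x, ENNReal.ofReal (‖fderiv ℝ v x‖ ^ p) ≤ 1 →
      ∫⁻ x, ENNReal.ofReal (weightedPower P (Module.finrank ℝ E) p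
        (Module.finrank ℝ E * p / (Module.finrank ℝ E - p)) v x) ≤ C := by
  set n := Module.finrank ℝ E with hn
  have hp0 : 0 < p := by linarith
  have hn0 : (0 : ℝ) < n := by linarith
  have hnp : 0 < n - p := by linarith
  set q : ℝ := n * p / (n - p) with hq
  have hq0 : 0 < q := by positivity
  set K := SNormLESNormFDerivOfEqConst ℝ (volume : Measure E) (p.toNNReal : ℝ)
  refine ⟨K ^ q, fun v hv hc h1 => ?_⟩
  have hS := eLpNorm_le_eLpNorm_fderiv_of_eq (volume : Measure E) hv hc
    (p := p.toNNReal) (p' := q.toNNReal) (by simpa using hp) (by exact_mod_cast hn0) (by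
      push_cast
      rw [Real.coe_toNNReal _ hp0.le, Real.coe_toNNReal _ hq0.le]
      change q⁻¹ = p⁻¹ - (n : ℝ)⁻¹
      rw [hq]; field_simp)
  rw [lintegral_ofReal_norm_rpow _ _ hp0] at h1
  have h2 : eLpNorm (fderiv ℝ v) (ENNReal.ofReal p) volume ≤ 1 := by
    rwa [← ENNReal.one_rpow p, ENNReal.rpow_le_rpow_iff hp0] at h1
  have e0 : n + q * (1 - n / p) = 0 := by
    rw [hq]; field_simp; ring
  calc ∫⁻ x, ENNReal.ofReal (weightedPower P n p q v x)
      = ∫⁻ x, ENNReal.ofReal (‖v x‖ ^ q) := by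
        simp [weightedPower, e0]
    _ = eLpNorm v (ENNReal.ofReal q) volume ^ q := lintegral_ofReal_norm_rpow _ _ hq0
    _ ≤ ((K : ℝ≥0∞) * 1) ^ q := by gcongr; exact hS.trans (by gcongr; exact h2)
    _ = _ := by rw [mul_one, ← ENNReal.coe_rpow_of_nonneg _ hq0.le]

/-- In case (a) v need not vanish near ker P, so absorption is done away from it, with constants
independent of δ; monotone convergence then lets δ → 0. -/
theorem lintegral_le_of_forall_lt_norm {P : E →L[ℝ] E} (hP : ∀ᵐ x : E, P x ≠ 0)
    (f : E → ℝ≥0∞) {C : ℝ≥0∞} (h : ∀ δ : ℝ, 0 < δ → ∫⁻ x in {x | δ < ‖P x‖}, f x ≤ C) :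
    ∫⁻ x, f x ≤ C := by
  have hu : (⋃ k : ℕ, {x | 1 / ((k : ℝ) + 1) < ‖P x‖}) =ᵐ[volume] (univ : Set E) := by
    rw [ae_eq_univ, ← compl_mem_ae_iff, compl_compl]
    filter_upwards [hP] with x hx
    obtain ⟨k, hk⟩ := exists_nat_one_div_lt (norm_pos_iff.2 hx)
    exact mem_iUnion.2 ⟨k, hk⟩
  rw [← setLIntegral_univ, ← setLIntegral_congr hu, setLIntegral_iUnion_of_directed]
  · exact iSup_le fun k => h _ Nat.one_div_pos_of_nat
  · refine Monotone.directed_le fun i j hij x hx => ?_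
    exact (Nat.one_div_le_one_div hij).trans_lt (mem_ofPred_eq ▸ hx)

/-- The subcritical range: the singular weight is locally integrable. -/
theorem exists_lintegral_weightedPower_le {P : E →L[ℝ] E} (hP : ∀ x, P (P x) = P x) {k : ℕ}
    (hk : Module.finrank ℝ (LinearMap.range (P : E →ₗ[ℝ] E)) = k) (hk1 : 1 < k) {p : ℝ}
    (hp : 1 ≤ p) (hpn : p < Module.finrank ℝ E) {q : ℝ} (hpq : p ≤ q)
    (hq : q ≤ Module.finrank ℝ E * p / (Module.finrank ℝ E - p))
    (hqk : Module.finrank ℝ E + q * (1 - Module.finrank ℝ E / p) < k) :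
    ∃ C : ℝ≥0, ∀ v : E → ℝ, ContDiff ℝ 1 v → HasCompactSupport v →
      ∫⁻ x, ENNReal.ofReal (‖fderiv ℝ v x‖ ^ p) ≤ 1 →
      ∫⁻ x, ENNReal.ofReal (weightedPower P (Module.finrank ℝ E) p q v x) ≤ C := by
  obtain ⟨C₁, hC₁⟩ := exists_lintegral_weightedPower_le_of_sobolev P hp hpn
  have hae := ae_map_ne_zero hk (by omega)
  set n : ℝ := (Module.finrank ℝ E : ℝ) with hn
  have hp0 : 0 < p := by linarith
  have hn0 : (0 : ℝ) < n := by linarith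
  have hnp : 0 < n - p := by linarith
  set q₁ : ℝ := n * p / (n - p) with hq₁
  -- For p > 1 the two bounds on q are equivalent to q ≤ (q - 1)p' and (q - 1)p' ≤ q₁, so Young's
  -- term interpolates between the quantity to be bounded and the Sobolev endpoint.
  have hsmall : ∀ q : ℝ, p ≤ q → q ≤ p * (n - 1) / (n - p) → n + q * (1 - n / p) < k →
      ∃ C : ℝ≥0, ∀ v : E → ℝ, ContDiff ℝ 1 v → HasCompactSupport v →
      ∫⁻ x, ENNReal.ofReal (‖fderiv ℝ v x‖ ^ p) ≤ 1 →
      ∫⁻ x, ENNReal.ofReal (weightedPower P n p q v x) ≤ C := by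
    intro q hpq hq hqk
    have hq1 : 1 ≤ q := hp.trans hpq
    set a := n + q * (1 - n / p) with ha
    obtain ⟨K, hK⟩ : ∃ K : ℝ≥0, (K : ℝ≥0∞) = (∫⁻ t in Ioi (1 : ℝ),
        ENNReal.ofReal (t ^ (a - 1 - k))) * ENNReal.ofReal q :=
      ⟨_, ENNReal.coe_toNNReal (ENNReal.mul_ne_top
        (lintegral_Ioi_rpow_lt_top (by linarith)).ne ENNReal.ofReal_ne_top)⟩
    have hardy : ∀ v : E → ℝ, ContDiff ℝ 1 v → HasCompactSupport v → ∀ δ : ℝ, 0 < δ →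
        ∫⁻ x in {x | δ < ‖P x‖}, ENNReal.ofReal (weightedPower P n p q v x) ≤
        K * ∫⁻ x in {x | δ < ‖P x‖}, ENNReal.ofReal
          (‖P x‖ ^ (1 - a) * (|v x| ^ (q - 1) * ‖fderiv ℝ v x‖)) := by
      intro v hv hc δ hδ
      rw [hK, mul_assoc]
      refine lintegral_rpow_le_of_dilation hP hk measurableSet_Ioi (Ioi_subset_Ioi zero_le_one)
        (measurableSet_lt measurable_const P.continuous.norm.measurable) ?_ a hq1 hv ?_
      · intro x hx t ht
        have hPt : P (x + (t - 1) • P x) = t • P x := by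
          rw [map_add, map_smul, hP]; module
        have ht1 : (1 : ℝ) < t := ht
        simp only [mem_ofPred_eq] at hx ⊢
        rw [hPt, norm_smul, Real.norm_of_nonneg (by linarith)]
        nlinarith
      · intro u hu huv x hx
        refine enorm_le_lintegral_dilation_Ioi P hu ?_ (norm_pos_iff.1 (hδ.trans hx))
        refine hc.mono fun x hx => ?_
        rw [Function.mem_support] at hx ⊢
        contrapose! hx
        simpa [hx, (by linarith : q ≠ 0)] using huv x
    rcases hp.eq_or_lt with rfl | hp1
    · have hq1' : q = 1 := by
        refine le_antisymm ?_ hq1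
        rwa [one_mul, div_self hnp.ne'] at hq
      refine ⟨K, fun v hv hc h1 => lintegral_le_of_forall_lt_norm hae _ fun δ hδ => ?_⟩
      refine (hardy v hv hc δ hδ).trans ?_
      calc _ ≤ (K : ℝ≥0∞) * 1 := by
            gcongr
            refine le_trans ?_ ((setLIntegral_le_lintegral {x | δ < ‖P x‖} _).trans h1)
            simp [ha, hq1']
        _ = K := mul_one _
    · have hpp := (Real.HolderConjugate.conjExponent hp1).symm
      set p' := p.conjExponent with hp'
      obtain ⟨C, hC⟩ := exists_lintegral_weightedPower_le_quarter (E := E) n hpp q K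
      have hp'e : p' = p / (p - 1) := rfl
      have hp10 : 0 < p - 1 := by linarith
      have hs₀ : q ≤ (q - 1) * p' := by
        rw [hp'e, ← mul_div_assoc, le_div_iff₀ hp10]; linarith
      have hs₁ : (q - 1) * p' ≤ q₁ := by
        rw [hp'e, hq₁, ← mul_div_assoc, div_le_div_iff₀ hp10 hnp]
        rw [le_div_iff₀ hnp] at hq
        nlinarith
      refine ⟨2 * (C₁ + C), fun v hv hc h1 =>
        lintegral_le_of_forall_lt_norm hae _ fun δ hδ => ?_⟩
      push_cast
      have hSm : MeasurableSet {x | δ < ‖P x‖} :=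
        measurableSet_lt measurable_const P.continuous.norm.measurable
      refine le_two_mul_of_le_half_add ?_ ?_
      · exact (lintegral_weightedPower_lt_top P n p (by linarith) hv.continuous hc hSm hδ
          fun x hx _ => (le_of_lt hx)).ne
      · refine ((hardy v hv hc δ hδ).trans (hC P _ v hae hv h1)).trans ?_
        have hi := lintegral_weightedPower_le_add hae n p (by linarith) hs₀ hs₁ hv.continuous
          {x | δ < ‖P x‖}
        have hi' : ∫⁻ x in {x | δ < ‖P x‖}, ENNReal.ofReal (weightedPower P n p q₁ v x) ≤ C₁ :=
          (setLIntegral_le_lintegral _ _).trans (hC₁ v hv hc h1)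
        calc _ ≤ 4⁻¹ * ((∫⁻ x in {x | δ < ‖P x‖}, ENNReal.ofReal (weightedPower P n p q v x)) +
              C₁) + C := by
              gcongr; exact hi.trans (by gcongr)
          _ = 4⁻¹ * (∫⁻ x in {x | δ < ‖P x‖}, ENNReal.ofReal (weightedPower P n p q v x)) +
              (4⁻¹ * C₁ + C) := by ring
          _ ≤ 2⁻¹ * (∫⁻ x in {x | δ < ‖P x‖}, ENNReal.ofReal (weightedPower P n p q v x)) +
              (1 * C₁ + C) := by
              gcongr
              · norm_num
              · rw [ENNReal.inv_le_one]; norm_num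
          _ = _ := by rw [one_mul]
  rcases le_total q (p * (n - 1) / (n - p)) with h | h
  · exact hsmall q hpq h hqk
  · have hn1 : n + p * (n - 1) / (n - p) * (1 - n / p) = 1 := by
      field_simp; ring
    have hp₀ : p ≤ p * (n - 1) / (n - p) := by
      rw [le_div_iff₀ hnp]; nlinarith
    obtain ⟨C, hC⟩ := hsmall _ hp₀ le_rfl (by rw [hn1]; exact_mod_cast hk1)
    refine ⟨C + C₁, fun v hv hc h1 => ?_⟩
    have := lintegral_weightedPower_le_add hae n p (by linarith) h hq hv.continuous univ
    simp only [setLIntegral_univ] at this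
    push_cast
    exact this.trans (add_le_add (hC v hv hc h1) (hC₁ v hv hc h1))

end

/-! ### Hardy's inequality for vanishing functions, and Morrey's inequality -/

section

variable {E : Type*} [NormedAddCommGroup E] [InnerProductSpace ℝ E] [FiniteDimensional ℝ E]
  [MeasurableSpace E] [BorelSpace E]

theorem lintegral_weightedPower_lt_top_of_ne_zero (P : E →L[ℝ] E) (n p : ℝ) {q : ℝ} (hq : 0 < q)
    {v : E → ℝ} (hv : Continuous v) (hc : HasCompactSupport v) {S : Set E} (hS : IsClosed S)
    (h : ∀ x ∈ tsupport v, x ∈ S → P x ≠ 0) :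
    ∫⁻ x in S, ENNReal.ofReal (weightedPower P n p q v x) < ⊤ := by
  obtain ⟨d, hd, hdx⟩ : ∃ d > 0, ∀ x ∈ tsupport v ∩ S, d ≤ ‖P x‖ := by
    rcases (tsupport v ∩ S).eq_empty_or_nonempty with h' | h'
    · exact ⟨1, one_pos, by simp [h']⟩
    · obtain ⟨x, hx, hmin⟩ := (hc.isCompact.inter_right hS).exists_isMinOn h'
        P.continuous.norm.continuousOn
      exact ⟨‖P x‖, norm_pos_iff.2 (h x hx.1 hx.2), fun y hy => hmin hy⟩
  exact lintegral_weightedPower_lt_top P n p hq hv hc hS.measurableSet hd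
    fun x hx h0 => hdx x ⟨subset_tsupport _ h0, hx⟩

/-- The `Lₚ` Hardy inequality for functions that vanish near the kernel of `P`, with `p > rank P`,
on a closed set that is star-shaped with respect to `ker P`. -/
theorem exists_setLIntegral_weightedPower_le_of_vanishing {P : E →L[ℝ] E}
    (hP : ∀ x, P (P x) = P x) {k : ℕ}
    (hk : Module.finrank ℝ (LinearMap.range (P : E →ₗ[ℝ] E)) = k) (hk0 : 0 < k) (n : ℝ) {p : ℝ}
    (hkp : k < p) (hp1 : 1 < p) {S : Set E} (hS : IsClosed S)
    (hSt : ∀ x ∈ S, ∀ t ∈ Ico (0 : ℝ) 1, x + (t - 1) • P x ∈ S) :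
    ∃ C : ℝ≥0, ∀ v : E → ℝ, ContDiff ℝ 1 v → HasCompactSupport v →
      (∀ x ∈ tsupport v, x ∈ S → P x ≠ 0) →
      ∫⁻ x, ENNReal.ofReal (‖fderiv ℝ v x‖ ^ p) ≤ 1 →
      ∫⁻ x in S, ENNReal.ofReal (weightedPower P n p p v x) ≤ C := by
  have hpp := (Real.HolderConjugate.conjExponent hp1).symm
  set p' := p.conjExponent with hp'
  have hp0 : 0 < p := by linarith
  have hae := ae_map_ne_zero hk hk0
  have ha : n + p * (1 - n / p) = p := by field_simp; ring
  -- For q = p Young's inequality reproduces the integrand on the left, so no second endpoint is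
  -- needed.
  have hs : (p - 1) * p' = p := by
    change (p - 1) * (p / (p - 1)) = p
    field_simp [(by linarith : p - 1 ≠ 0)]
  obtain ⟨K, hK⟩ : ∃ K : ℝ≥0, (K : ℝ≥0∞) = (∫⁻ t in Ioo (0 : ℝ) 1,
      ENNReal.ofReal (t ^ (p - 1 - k))) * ENNReal.ofReal p :=
    ⟨_, ENNReal.coe_toNNReal (ENNReal.mul_ne_top
      (lintegral_Ioo_rpow_lt_top (by linarith)).ne ENNReal.ofReal_ne_top)⟩
  obtain ⟨C, hC⟩ := exists_lintegral_weightedPower_le_quarter (E := E) n hpp p K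
  refine ⟨2 * C, fun v hv hc hvS h1 => ?_⟩
  push_cast
  have hC' := hC P S v hae hv h1
  rw [hs, ha] at hC'
  have hardy := lintegral_rpow_le_of_dilation hP hk measurableSet_Ioo
    (J := Ioo (0 : ℝ) 1) (fun t ht => ht.1) hS.measurableSet
    (fun x hx t ht => hSt x hx t ⟨ht.1.le, ht.2⟩) p hp1.le hv (by
      intro u hu huv x hx
      refine enorm_le_lintegral_dilation_Ioo P hu ?_
      have hx0 : x - P x ∈ S := by
        have := hSt x hx 0 ⟨le_rfl, one_pos⟩
        simpa [← sub_eq_add_neg] using this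
      have : v (x - P x) = 0 := by
        by_contra h
        exact hvS _ (subset_tsupport _ h) hx0 (by rw [map_sub, hP, sub_self])
      simpa [this, hp0.ne'] using huv (x - P x))
  rw [← mul_assoc, ← hK] at hardy
  have e : ∀ x, ‖P x‖ ^ (-p) * |v x| ^ p = weightedPower P n p p v x := fun x => by
    rw [weightedPower, ha]
  simp only [e] at hardy
  refine le_two_mul_of_le_half_add ?_ ((hardy.trans hC').trans ?_)
  · exact (lintegral_weightedPower_lt_top_of_ne_zero P n p hp0 hv.continuous hc hS hvS).ne
  · gcongr
    norm_num

/-- Morrey's inequality, for functions normalized by `∫ |∇v|^p ≤ 1`. -/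
theorem exists_enorm_sub_le_rpow {p : ℝ} (hp1 : 1 ≤ p) (hnp : Module.finrank ℝ E < p) :
    ∃ K : ℝ≥0, ∀ v : E → ℝ, ContDiff ℝ 1 v →
      ∫⁻ x, ENNReal.ofReal (‖fderiv ℝ v x‖ ^ p) ≤ 1 → ∀ x x₀ : E, x ≠ x₀ →
      ‖v x - v x₀‖ₑ ≤ K * ENNReal.ofReal (‖x - x₀‖ ^ (1 - Module.finrank ℝ E / p)) := by
  set N := Module.finrank ℝ E with hN
  set n : ℝ := (N : ℝ) with hn
  have hp0 : 0 < p := by linarith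
  have hn0 : 0 ≤ n := Nat.cast_nonneg _
  have hnp1 : n / p < 1 := by rwa [div_lt_one hp0]
  set β : ℝ≥0∞ := volume (Metric.ball (0 : E) 1) with hβ
  have hβ0 : β ≠ 0 := (Metric.measure_ball_pos _ _ one_pos).ne'
  have hβt : β ≠ ⊤ := measure_ball_lt_top.ne
  set c : ℝ≥0∞ := ∫⁻ t in Ioo (0 : ℝ) 1, ENNReal.ofReal (t ^ (-(n / p))) with hc
  have hct : c ≠ ⊤ := (lintegral_Ioo_rpow_lt_top (by linarith)).ne
  have hKt : β⁻¹ * (4 * ((β + 1) * c)) ≠ ⊤ :=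
    ENNReal.mul_ne_top (ENNReal.inv_ne_top.2 hβ0) (ENNReal.mul_ne_top (by norm_num)
      (ENNReal.mul_ne_top (by simp [hβt]) hct))
  refine ⟨(β⁻¹ * (4 * ((β + 1) * c))).toNNReal, fun v hv h1 x x₀ hne => ?_⟩
  rw [ENNReal.coe_toNNReal hKt]
  set r := ‖x - x₀‖ with hr
  have hr0 : 0 < r := norm_pos_iff.2 (sub_ne_zero.2 hne)
  set B := Metric.closedBall x₀ r with hB
  have hBv : volume B = ENNReal.ofReal (r ^ N) * β := Measure.addHaar_closedBall _ _ hr0.le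
  have hdc : Continuous (fderiv ℝ v) := hv.continuous_fderiv one_ne_zero
  set g : E → ℝ≥0∞ := fun y => ENNReal.ofReal (‖fderiv ℝ v y‖ ^ p) with hg
  have hgm : Measurable g := (hdc.norm.measurable.pow_const _).ennreal_ofReal
  have hscale : ∀ z : E, ∀ t : ℝ, 0 < t → ∫⁻ w, g (z + t • (w - z)) ≤
      ENNReal.ofReal (t ^ (-n)) := by
    intro z t ht
    have hgz : Measurable fun y => g (z + y) := hgm.comp (measurable_const_add z)
    have e1 := lintegral_sub_right_eq_self (μ := (volume : Measure E)) (fun y => g (z + t • y)) z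
    have e2 := lintegral_comp_dilation (P := ContinuousLinearMap.id ℝ E) (fun _ => rfl)
      (k := N) (by rw [ContinuousLinearMap.coe_id, LinearMap.range_id, finrank_top]) ht hgz
    have e3 := lintegral_add_left_eq_self (μ := (volume : Measure E)) g z
    rw [e1]
    have e4 : ∀ y : E, y + (t - 1) • y = t • y := fun y => by module
    simp only [ContinuousLinearMap.id_apply, e4, e3] at e2
    rw [e2]
    calc _ ≤ ENNReal.ofReal (t ^ (-n)) * 1 := by gcongr
      _ = _ := mul_one _
  -- The mean oscillation about any point of the ball. It is used for z = x and z = x₀, and the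
  -- triangle inequality through w finishes.
  have havg : ∀ z ∈ B, ∫⁻ w in B, ‖v w - v z‖ₑ ≤
      ENNReal.ofReal (r ^ N) * (ENNReal.ofReal (r ^ (1 - n / p)) * (2 * ((β + 1) * c))) := by
    intro z hz
    have hpt : ∀ w ∈ B, ‖v w - v z‖ₑ ≤ ∫⁻ t in Ioo (0 : ℝ) 1, ENNReal.ofReal (2 * r) *
        (ENNReal.ofReal ((t * r) ^ (-(n / p))) +
          ENNReal.ofReal ((t * r) ^ (n - n / p)) * g (z + t • (w - z))) := by
      intro w hw
      have h := enorm_sub_le_lintegral_fderiv hv (γ := fun t => z + t • (w - z))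
        (γ' := fun _ => w - z) (fun t => by
          simpa using ((hasDerivAt_id t).smul_const (w - z)).const_add z)
        continuous_const zero_le_one
      rw [setLIntegral_congr (Ioo_ae_eq_Icc (a := (0 : ℝ)) (b := 1)).symm] at h
      simp only [one_smul, add_sub_cancel, zero_smul, add_zero] at h
      refine h.trans (setLIntegral_mono' measurableSet_Ioo fun t ht => ?_)
      have hwz : ‖w - z‖ ≤ 2 * r := by
        rw [← dist_eq_norm]
        have := dist_triangle_right w z x₀
        rw [hB, Metric.mem_closedBall] at hw hz
        linarith
      have htr : 0 < t * r := mul_pos ht.1 hr0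
      simp only [hg]
      rw [← ofReal_norm, ← ofReal_norm, ← ENNReal.ofReal_mul (by positivity),
        ← ENNReal.ofReal_mul (p := (t * r) ^ (n - n / p)) (by positivity),
        ← ENNReal.ofReal_add (by positivity) (by positivity),
        ← ENNReal.ofReal_mul (by positivity)]
      refine ENNReal.ofReal_le_ofReal ?_
      gcongr
      -- With λ = (t r)^(-n/p), G ≤ λ + λ^(1-p) G^p. This λ makes both terms, once integrated over
      -- w, multiples of t^(-n/p), which is integrable on (0, 1) since p > n.
      set G := ‖fderiv ℝ v (z + t • (w - z))‖ with hG
      have hG0 : 0 ≤ G := norm_nonneg _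
      rcases le_total G ((t * r) ^ (-(n / p))) with hle | hle
      · have : 0 ≤ (t * r) ^ (n - n / p) * G ^ p := by positivity
        linarith
      · have hlam : 0 < (t * r) ^ (-(n / p)) := by positivity
        have hGp : 0 < G := hlam.trans_le hle
        have e1 : ((t * r) ^ (-(n / p))) ^ (p - 1) ≤ G ^ (p - 1) :=
          Real.rpow_le_rpow hlam.le hle (by linarith)
        have e2 : (t * r) ^ (n - n / p) * ((t * r) ^ (-(n / p))) ^ (p - 1) = 1 := by
          rw [← Real.rpow_mul htr.le, ← Real.rpow_add htr]
          have : n - n / p + -(n / p) * (p - 1) = 0 := by field_simp; ring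
          rw [this, Real.rpow_zero]
        have e3 : G ^ p = G ^ (p - 1) * G := by
          rw [← Real.rpow_add_one hGp.ne']; ring_nf
        have e4 : G ≤ (t * r) ^ (n - n / p) * G ^ p := by
          rw [e3, ← mul_assoc]
          calc G = (t * r) ^ (n - n / p) * ((t * r) ^ (-(n / p))) ^ (p - 1) * G := by
                rw [e2, one_mul]
            _ ≤ _ := by gcongr
        linarith
    have hmeas : Measurable (Function.uncurry fun (w : E) (t : ℝ) => ENNReal.ofReal (2 * r) *
        (ENNReal.ofReal ((t * r) ^ (-(n / p))) +
          ENNReal.ofReal ((t * r) ^ (n - n / p)) * g (z + t • (w - z)))) := by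
      have m1 : ∀ s : ℝ, Measurable fun y : E × ℝ => ENNReal.ofReal ((y.2 * r) ^ s) := fun s =>
        ((measurable_snd.mul_const r).pow_const s).ennreal_ofReal
      have m2 : Continuous fun y : E × ℝ => z + y.2 • (y.1 - z) := by fun_prop
      exact ((m1 _).add ((m1 _).mul (hgm.comp m2.measurable))).const_mul _
    calc ∫⁻ w in B, ‖v w - v z‖ₑ
        ≤ ∫⁻ w in B, ∫⁻ t in Ioo (0 : ℝ) 1, ENNReal.ofReal (2 * r) *
          (ENNReal.ofReal ((t * r) ^ (-(n / p))) +
            ENNReal.ofReal ((t * r) ^ (n - n / p)) * g (z + t • (w - z))) :=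
          setLIntegral_mono' Metric.isClosed_closedBall.measurableSet hpt
      _ = ∫⁻ t in Ioo (0 : ℝ) 1, ∫⁻ w in B, ENNReal.ofReal (2 * r) *
          (ENNReal.ofReal ((t * r) ^ (-(n / p))) +
            ENNReal.ofReal ((t * r) ^ (n - n / p)) * g (z + t • (w - z))) :=
          lintegral_lintegral_swap hmeas.aemeasurable
      _ ≤ ∫⁻ t in Ioo (0 : ℝ) 1, (ENNReal.ofReal (r ^ N) * (ENNReal.ofReal (r ^ (1 - n / p)) *
          (2 * (β + 1)))) * ENNReal.ofReal (t ^ (-(n / p))) := by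
          refine setLIntegral_mono' measurableSet_Ioo fun t ht => ?_
          have ht0 : 0 < t := ht.1
          have htr : 0 < t * r := mul_pos ht.1 hr0
          have e1 : (t * r) ^ (n - n / p) * t ^ (-n) = r ^ N * (t * r) ^ (-(n / p)) := by
            rw [sub_eq_add_neg, Real.rpow_add htr, Real.mul_rpow ht0.le hr0.le (z := n),
              Real.rpow_neg ht0.le n, hn, Real.rpow_natCast, Real.rpow_natCast]
            field_simp
          have e2 : r * (t * r) ^ (-(n / p)) = r ^ (1 - n / p) * t ^ (-(n / p)) := by
            rw [Real.mul_rpow ht0.le hr0.le, sub_eq_add_neg 1, Real.rpow_add hr0, Real.rpow_one]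
            ring
          rw [lintegral_const_mul' _ _ ENNReal.ofReal_ne_top, lintegral_add_left measurable_const,
            lintegral_const_mul' _ _ ENNReal.ofReal_ne_top, setLIntegral_const, hBv]
          calc _ ≤ ENNReal.ofReal (2 * r) * (ENNReal.ofReal ((t * r) ^ (-(n / p))) *
                (ENNReal.ofReal (r ^ N) * β) + ENNReal.ofReal ((t * r) ^ (n - n / p)) *
                  ENNReal.ofReal (t ^ (-n))) := by
                gcongr
                exact (setLIntegral_le_lintegral _ _).trans (hscale z t ht0)
            _ = ENNReal.ofReal (r ^ N) * (2 * (β + 1)) *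
                ENNReal.ofReal (r * (t * r) ^ (-(n / p))) := by
                rw [← ENNReal.ofReal_mul (by positivity) (p := (t * r) ^ (n - n / p)), e1,
                  ENNReal.ofReal_mul (by positivity), ENNReal.ofReal_mul (by positivity),
                  ENNReal.ofReal_mul (by positivity)]
                simp only [ENNReal.ofReal_ofNat]
                ring
            _ = _ := by
                rw [e2, ENNReal.ofReal_mul (by positivity)]
                ring
      _ = _ := by
          rw [lintegral_const_mul _ (f := fun t : ℝ => ENNReal.ofReal (t ^ (-(n / p))))
            ((measurable_id.pow_const _).ennreal_ofReal), ← hc]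
          ring
  have hx : x ∈ B := by rw [hB, Metric.mem_closedBall, dist_eq_norm]
  have hx₀ : x₀ ∈ B := Metric.mem_closedBall_self hr0.le
  have hvm : ∀ z, Measurable fun w => ‖v w - v z‖ₑ := fun z =>
    (hv.continuous.sub continuous_const).enorm.measurable
  have hsum : ‖v x - v x₀‖ₑ * (ENNReal.ofReal (r ^ N) * β) ≤
      ENNReal.ofReal (r ^ N) * (ENNReal.ofReal (r ^ (1 - n / p)) * (4 * ((β + 1) * c))) := by
    calc _ = ∫⁻ _ in B, ‖v x - v x₀‖ₑ := by rw [setLIntegral_const, hBv]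
      _ ≤ ∫⁻ w in B, (‖v w - v x‖ₑ + ‖v w - v x₀‖ₑ) := by
          refine lintegral_mono fun w => ?_
          have : v x - v x₀ = (v w - v x₀) - (v w - v x) := by ring
          rw [this, add_comm]
          exact enorm_sub_le
      _ = (∫⁻ w in B, ‖v w - v x‖ₑ) + ∫⁻ w in B, ‖v w - v x₀‖ₑ := lintegral_add_left (hvm x) _
      _ ≤ _ := add_le_add (havg x hx) (havg x₀ hx₀)
      _ = _ := by ring
  have hrN0 : ENNReal.ofReal (r ^ N) ≠ 0 := by
    simpa using pow_pos hr0 N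
  calc ‖v x - v x₀‖ₑ = β⁻¹ * ((ENNReal.ofReal (r ^ N))⁻¹ *
        (‖v x - v x₀‖ₑ * (ENNReal.ofReal (r ^ N) * β))) := by
        have h1 := ENNReal.inv_mul_cancel hβ0 hβt
        have h2 := ENNReal.inv_mul_cancel hrN0 ENNReal.ofReal_ne_top
        calc _ = ‖v x - v x₀‖ₑ * (β⁻¹ * β) *
              ((ENNReal.ofReal (r ^ N))⁻¹ * ENNReal.ofReal (r ^ N)) := by
              rw [h1, h2, mul_one, mul_one]
          _ = _ := by ring
    _ ≤ β⁻¹ * ((ENNReal.ofReal (r ^ N))⁻¹ * (ENNReal.ofReal (r ^ N) *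
        (ENNReal.ofReal (r ^ (1 - n / p)) * (4 * ((β + 1) * c))))) := by gcongr
    _ = ((ENNReal.ofReal (r ^ N))⁻¹ * ENNReal.ofReal (r ^ N)) * (β⁻¹ * (4 * ((β + 1) * c)) *
        ENNReal.ofReal (r ^ (1 - n / p))) := by ring
    _ = _ := by rw [ENNReal.inv_mul_cancel hrN0 ENNReal.ofReal_ne_top, one_mul]

end

/-! ### Products with a power of the distance to the kernel -/

section

variable {E : Type*} [NormedAddCommGroup E] [InnerProductSpace ℝ E]

theorem contDiff_norm_rpow_mul {P : E →L[ℝ] E} {w : E → ℝ} (hw : ContDiff ℝ 1 w)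
    (h : ∀ x ∈ tsupport w, P x ≠ 0) (s : ℝ) : ContDiff ℝ 1 fun x => ‖P x‖ ^ s * w x := by
  rw [contDiff_iff_contDiffAt]
  intro x
  by_cases hx : x ∈ tsupport w
  · have h1 : ContDiffAt ℝ 1 (fun x => ‖P x‖) x :=
      (contDiffAt_norm ℝ (h x hx)).comp x P.contDiff.contDiffAt
    exact (h1.rpow_const_of_ne (norm_ne_zero_iff.2 (h x hx))).mul hw.contDiffAt
  · have : (fun x => ‖P x‖ ^ s * w x) =ᶠ[𝓝 x] fun _ => 0 := by
      filter_upwards [notMem_tsupport_iff_eventuallyEq.1 hx] with y hy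
      simp [hy]
    exact contDiffAt_const.congr_of_eventuallyEq this

/-- Product rule; x ↦ ‖P x‖ is 1-Lipschitz because P is a contraction. -/
theorem norm_fderiv_norm_rpow_mul_le {P : E →L[ℝ] E} (hP1 : ∀ x, ‖P x‖ ≤ ‖x‖) {w : E → ℝ}
    {x : E} (hw : DifferentiableAt ℝ w x) (hx : P x ≠ 0) (s : ℝ) :
    ‖fderiv ℝ (fun x => ‖P x‖ ^ s * w x) x‖ ≤
      |s| * (‖P x‖ ^ (s - 1) * |w x|) + ‖P x‖ ^ s * ‖fderiv ℝ w x‖ := by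
  have hy := norm_pos_iff.2 hx
  have h1 : DifferentiableAt ℝ (fun x => ‖P x‖) x :=
    ((contDiffAt_norm ℝ hx).differentiableAt one_ne_zero).comp x P.differentiableAt
  have h2 : ‖fderiv ℝ (fun x => ‖P x‖) x‖ ≤ 1 := by
    have : LipschitzWith 1 fun x => ‖P x‖ := by
      refine LipschitzWith.of_dist_le_mul fun a b => ?_
      rw [NNReal.coe_one, one_mul, Real.dist_eq, dist_eq_norm]
      refine (abs_norm_sub_norm_le _ _).trans ?_
      rw [← map_sub]
      exact hP1 _
    simpa using norm_fderiv_le_of_lipschitz ℝ this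
  have h3 := h1.hasFDerivAt.rpow_const (p := s) (Or.inl hy.ne')
  have h4 : HasFDerivAt (fun x => ‖P x‖ ^ s * w x) _ x := h3.mul hw.hasFDerivAt
  rw [h4.fderiv, add_comm]
  refine (norm_add_le _ _).trans (add_le_add ?_ ?_)
  · rw [norm_smul, norm_smul, Real.norm_eq_abs, Real.norm_eq_abs, abs_mul,
      abs_of_pos (Real.rpow_pos_of_pos hy _)]
    calc |w x| * (|s| * ‖P x‖ ^ (s - 1) * ‖fderiv ℝ (fun x => ‖P x‖) x‖)
        ≤ |w x| * (|s| * ‖P x‖ ^ (s - 1) * 1) := by gcongr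
      _ = _ := by ring
  · rw [norm_smul, Real.norm_of_nonneg (by positivity)]

end

/-! ### Functions vanishing near the plane: case (b) -/

section

variable {E : Type*} [NormedAddCommGroup E] [InnerProductSpace ℝ E] [FiniteDimensional ℝ E]
  [MeasurableSpace E] [BorelSpace E]

/-- In the critical case `p = n`, the integrability exponent improves by `n / (n - 1)`. -/
theorem exists_lintegral_weightedPower_critical_step {P : E →L[ℝ] E} (hP1 : ∀ x, ‖P x‖ ≤ ‖x‖)
    (hae : ∀ᵐ x : E, P x ≠ 0) {n : ℝ} (hn : Module.finrank ℝ E = n) (hn1 : 1 < n) {q : ℝ}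
    (hq : n ≤ q) (A B : ℝ≥0) :
    ∃ C : ℝ≥0, ∀ v : E → ℝ, ContDiff ℝ 1 v → HasCompactSupport v →
      (∀ x ∈ tsupport v, P x ≠ 0) →
      ∫⁻ x, ENNReal.ofReal (‖fderiv ℝ v x‖ ^ n) ≤ 1 →
      ∫⁻ x, ENNReal.ofReal (weightedPower P n n n v x) ≤ A →
      ∫⁻ x, ENNReal.ofReal (weightedPower P n n q v x) ≤ B →
      ∫⁻ x, ENNReal.ofReal (weightedPower P n n (q + n / (n - 1)) v x) ≤ C := by
  have hn0 : 0 < n := by linarith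
  have hn10 : 0 < n - 1 := by linarith
  have hpp := Real.HolderConjugate.conjExponent hn1
  set n' := n.conjExponent with hn'
  have hn'e : n' = n / (n - 1) := rfl
  obtain ⟨C, hC, hyoung⟩ := exists_hardy_integrand_le (E := E) n hpp.symm
    (q / n' + 1) one_pos
  -- The L₁ Sobolev inequality is applied to u = |y|^(1-n)|v|^γ. Since (1 - n)n' = -n and γn' = q +
  -- n', |u|^n' is the integrand with the raised exponent. In ∇u, the derivative of the weight gives
  -- exponent γ ∈ [n, q], and the derivative of |v|^γ gives, by Young, exponent (γ - 1)n' = q.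
  set γ := q / n' + 1 with hγ
  have hn'0 : 0 < n' := hpp.symm.pos
  have hγq : (γ - 1) * n' = q := by rw [hγ]; field_simp; ring
  have hγ1 : 1 < γ := by
    have : 0 < q / n' := div_pos (by linarith) hn'0
    linarith
  have hγ0 : 0 < γ := by linarith
  have hγe : γ = q * (n - 1) / n + 1 := by rw [hγ, hn'e]; field_simp
  have hγ₀ : n ≤ γ := by
    rw [hγe, ← sub_le_iff_le_add, le_div_iff₀ hn0]; nlinarith
  have hγ₁ : γ ≤ q := by
    rw [hγe, ← le_sub_iff_add_le, div_le_iff₀ hn0]; nlinarith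
  have hwp : ∀ (s : ℝ) (v : E → ℝ) (x : E),
      weightedPower P n n s v x = ‖P x‖ ^ (-n) * |v x| ^ s := fun s v x => by
    rw [weightedPower, div_self hn0.ne', sub_self, mul_zero, add_zero]
  set K := lintegralPowLePowLIntegralFDerivConst (volume : Measure E) n'
  set D : ℝ≥0 := (n - 1).toNNReal * (A + B) + γ.toNNReal * (B + C.toNNReal) with hD
  refine ⟨K * D ^ n', fun v hv hc hvP h1 hA hB => ?_⟩
  set w : E → ℝ := fun x => ‖v x‖ ^ γ with hw
  have hwc : ContDiff ℝ 1 w := hv.norm_rpow hγ1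
  have hwsupp : Function.support w ⊆ Function.support v := by
    intro x hx
    rw [Function.mem_support] at hx ⊢
    contrapose! hx
    simp [hw, hx, hγ0.ne']
  set u : E → ℝ := fun x => ‖P x‖ ^ (1 - n) * w x with hu
  have huc : ContDiff ℝ 1 u := contDiff_norm_rpow_mul hwc
    (fun x hx => hvP x (closure_mono hwsupp hx)) _
  have hus : HasCompactSupport u := by
    refine hc.mono fun x hx => hwsupp ?_
    rw [Function.mem_support] at hx ⊢
    contrapose! hx
    simp [hu, hx]
  have gns := lintegral_pow_le_pow_lintegral_fderiv (volume : Measure E) huc hus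
    (p := n') (by rw [hn]; exact hpp)
  have hgrad : ∫⁻ x, ‖fderiv ℝ u x‖ₑ ≤ D := by
    have hpt : ∀ᵐ x : E, ‖fderiv ℝ u x‖ₑ ≤
        ENNReal.ofReal (n - 1) * ENNReal.ofReal (weightedPower P n n γ v x) +
        ENNReal.ofReal γ * (ENNReal.ofReal (weightedPower P n n q v x) +
          ENNReal.ofReal C * ENNReal.ofReal (‖fderiv ℝ v x‖ ^ n)) := by
      filter_upwards [hae] with x hx
      rw [← ofReal_norm, ← ENNReal.ofReal_mul hC.le,
        ← ENNReal.ofReal_add (weightedPower_nonneg ..) (by positivity),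
        ← ENNReal.ofReal_mul hγ0.le, ← ENNReal.ofReal_mul hn10.le, ← ENNReal.ofReal_add
          (mul_nonneg hn10.le (weightedPower_nonneg ..)) (mul_nonneg hγ0.le
            (add_nonneg (weightedPower_nonneg ..) (by positivity)))]
      refine ENNReal.ofReal_le_ofReal ?_
      refine (norm_fderiv_norm_rpow_mul_le hP1 (hwc.differentiable one_ne_zero x) hx _).trans ?_
      have h2 := hyoung P v x hx
      rw [one_mul, hγq, div_self hn0.ne', sub_self, mul_zero, add_zero] at h2
      have h3 : ‖fderiv ℝ w x‖ ≤ γ * ‖v x‖ ^ (γ - 1) * ‖fderiv ℝ v x‖ :=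
        norm_fderiv_norm_rpow_le (hv.differentiable one_ne_zero) hγ1
      refine add_le_add (le_of_eq ?_) ?_
      · have h4 : |w x| = |v x| ^ γ := abs_of_nonneg (by positivity)
        rw [hwp, h4, abs_of_neg (by linarith)]
        ring_nf
      · calc ‖P x‖ ^ (1 - n) * ‖fderiv ℝ w x‖
            ≤ ‖P x‖ ^ (1 - n) * (γ * ‖v x‖ ^ (γ - 1) * ‖fderiv ℝ v x‖) := by gcongr
          _ = γ * (‖P x‖ ^ (1 - n) * (|v x| ^ (γ - 1) * ‖fderiv ℝ v x‖)) := by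
            rw [Real.norm_eq_abs]; ring
          _ ≤ _ := by gcongr
    have hdm : Measurable fun x => ENNReal.ofReal (‖fderiv ℝ v x‖ ^ n) :=
      ((hv.continuous_fderiv one_ne_zero).norm.measurable.pow_const _).ennreal_ofReal
    have hm : ∀ s, Measurable fun x => ENNReal.ofReal (weightedPower P n n s v x) := fun s =>
      (measurable_weightedPower P n n s hv.continuous).ennreal_ofReal
    have hi := lintegral_weightedPower_le_add hae n n hn0 hγ₀ hγ₁ hv.continuous univ
    simp only [setLIntegral_univ] at hi
    refine (lintegral_mono_ae hpt).trans ?_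
    rw [lintegral_add_left ((hm _).const_mul _), lintegral_const_mul _ (hm _),
      lintegral_const_mul' _ _ ENNReal.ofReal_ne_top, lintegral_add_left (hm _),
      lintegral_const_mul _ hdm, hD]
    push_cast
    refine add_le_add (mul_le_mul_right (hi.trans (add_le_add hA hB)) _)
      (mul_le_mul_right (add_le_add hB ?_) _)
    calc _ ≤ ENNReal.ofReal C * 1 := mul_le_mul_right h1 _
      _ = _ := mul_one _
  have hpow : ∀ x, P x ≠ 0 → ENNReal.ofReal (weightedPower P n n (q + n / (n - 1)) v x) =
      ‖u x‖ₑ ^ n' := by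
    intro x hx
    have hy := norm_pos_iff.2 hx
    have hux : u x = ‖P x‖ ^ (1 - n) * |v x| ^ γ := rfl
    rw [← ofReal_norm, ENNReal.ofReal_rpow_of_nonneg (norm_nonneg _) hn'0.le, hwp, hux,
      Real.norm_of_nonneg (by positivity), Real.mul_rpow (by positivity) (by positivity),
      ← Real.rpow_mul hy.le, ← Real.rpow_mul (abs_nonneg _)]
    have e1 : (1 - n) * n' = -n := by rw [hn'e]; field_simp; ring
    have e2 : γ * n' = q + n / (n - 1) := by rw [← hn'e, ← hγq]; ring
    rw [e1, e2]
  calc _ = ∫⁻ x, ‖u x‖ₑ ^ n' := lintegral_congr_ae (hae.mono hpow)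
    _ ≤ K * (∫⁻ x, ‖fderiv ℝ u x‖ₑ) ^ n' := gns
    _ ≤ K * (D : ℝ≥0∞) ^ n' := by gcongr
    _ = _ := by rw [ENNReal.coe_mul, ENNReal.coe_rpow_of_nonneg _ hn'0.le]

/-- Morrey's inequality between x and its foot x - P x in ker P, where v = 0 and whose distance from
x is ‖P x‖. -/
theorem exists_rpow_mul_abs_le_of_vanishing {P : E →L[ℝ] E} (hP : ∀ x, P (P x) = P x) {p : ℝ}
    (hp1 : 1 ≤ p) (hnp : Module.finrank ℝ E < p) :
    ∃ M : ℝ≥0, ∀ v : E → ℝ, ContDiff ℝ 1 v → (∀ x ∈ tsupport v, P x ≠ 0) →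
      ∫⁻ x, ENNReal.ofReal (‖fderiv ℝ v x‖ ^ p) ≤ 1 →
      ∀ x, P x ≠ 0 → ‖P x‖ ^ (-(1 - Module.finrank ℝ E / p)) * |v x| ≤ M := by
  obtain ⟨M, hM⟩ := exists_enorm_sub_le_rpow (E := E) hp1 hnp
  refine ⟨M, fun v hv hvP h1 x hx => ?_⟩
  have hy := norm_pos_iff.2 hx
  have h0 : v (x - P x) = 0 := by
    by_contra h
    exact hvP _ (subset_tsupport _ h) (by rw [map_sub, hP, sub_self])
  have h := hM v hv h1 x (x - P x) (fun e => hx (by rwa [eq_comm, sub_eq_self] at e))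
  rw [h0, sub_zero, sub_sub_cancel, ← ofReal_norm, ← ENNReal.ofReal_coe_nnreal,
    ← ENNReal.ofReal_mul (NNReal.coe_nonneg _), ENNReal.ofReal_le_ofReal_iff (by positivity),
    Real.norm_eq_abs] at h
  rw [Real.rpow_neg hy.le, ← div_eq_inv_mul, div_le_iff₀ (by positivity)]
  exact h

/-- Hardy's inequality gives the exponent p; a second, larger exponent (or a supremum bound when p
exceeds the dimension) then reaches q. -/
theorem exists_lintegral_weightedPower_le_of_vanishing {P : E →L[ℝ] E}
    (hP : ∀ x, P (P x) = P x) (hP1 : ∀ x, ‖P x‖ ≤ ‖x‖) {k : ℕ}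
    (hk : Module.finrank ℝ (LinearMap.range (P : E →ₗ[ℝ] E)) = k) (hk1 : 1 < k) {p : ℝ}
    (hkp : k < p) {q : ℝ} (hpq : p ≤ q)
    (hq : p < Module.finrank ℝ E → q ≤ Module.finrank ℝ E * p / (Module.finrank ℝ E - p)) :
    ∃ C : ℝ≥0, ∀ v : E → ℝ, ContDiff ℝ 1 v → HasCompactSupport v →
      (∀ x ∈ tsupport v, P x ≠ 0) →
      ∫⁻ x, ENNReal.ofReal (‖fderiv ℝ v x‖ ^ p) ≤ 1 →
      ∫⁻ x, ENNReal.ofReal (weightedPower P (Module.finrank ℝ E) p q v x) ≤ C := by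
  have hae := ae_map_ne_zero hk (by omega)
  have hk1' : (1 : ℝ) < k := by exact_mod_cast hk1
  have hp1 : 1 < p := by linarith
  have hp0 : 0 < p := by linarith
  set n : ℝ := (Module.finrank ℝ E : ℝ) with hn
  have hn1 : 1 < n := by
    have : k ≤ Module.finrank ℝ E := hk ▸ Submodule.finrank_le _
    have : (k : ℝ) ≤ n := by rw [hn]; exact_mod_cast this
    linarith
  obtain ⟨C₀, hC₀⟩ : ∃ C : ℝ≥0, ∀ v : E → ℝ, ContDiff ℝ 1 v → HasCompactSupport v →
      (∀ x ∈ tsupport v, P x ≠ 0) → ∫⁻ x, ENNReal.ofReal (‖fderiv ℝ v x‖ ^ p) ≤ 1 →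
      ∫⁻ x, ENNReal.ofReal (weightedPower P n p p v x) ≤ C := by
    obtain ⟨C, hC⟩ := exists_setLIntegral_weightedPower_le_of_vanishing hP hk (by omega) n hkp hp1
      isClosed_univ (fun _ _ _ _ => mem_univ _)
    refine ⟨C, fun v hv hc hvP h1 => ?_⟩
    simpa using hC v hv hc (fun x hx _ => hvP x hx) h1
  have hinterp : ∀ q₁, q ≤ q₁ → (∃ C : ℝ≥0, ∀ v : E → ℝ, ContDiff ℝ 1 v → HasCompactSupport v →
      (∀ x ∈ tsupport v, P x ≠ 0) → ∫⁻ x, ENNReal.ofReal (‖fderiv ℝ v x‖ ^ p) ≤ 1 →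
      ∫⁻ x, ENNReal.ofReal (weightedPower P n p q₁ v x) ≤ C) →
      ∃ C : ℝ≥0, ∀ v : E → ℝ, ContDiff ℝ 1 v → HasCompactSupport v →
      (∀ x ∈ tsupport v, P x ≠ 0) → ∫⁻ x, ENNReal.ofReal (‖fderiv ℝ v x‖ ^ p) ≤ 1 →
      ∫⁻ x, ENNReal.ofReal (weightedPower P n p q v x) ≤ C := by
    rintro q₁ hq₁ ⟨C₁, hC₁⟩
    refine ⟨C₀ + C₁, fun v hv hc hvP h1 => ?_⟩
    have hi := lintegral_weightedPower_le_add hae n p hp0 hpq hq₁ hv.continuous univ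
    simp only [setLIntegral_univ] at hi
    push_cast
    exact hi.trans (add_le_add (hC₀ v hv hc hvP h1) (hC₁ v hv hc hvP h1))
  rcases lt_trichotomy p n with hpn | rfl | hnp
  · obtain ⟨C₁, hC₁⟩ := exists_lintegral_weightedPower_le_of_sobolev P hp1.le hpn
    exact hinterp _ (hq hpn) ⟨C₁, fun v hv hc _ h1 => hC₁ v hv hc h1⟩
  · have hstep : 0 < n / (n - 1) := div_pos hp0 (by linarith)
    have hind : ∀ j : ℕ, ∃ C : ℝ≥0, ∀ v : E → ℝ, ContDiff ℝ 1 v → HasCompactSupport v →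
        (∀ x ∈ tsupport v, P x ≠ 0) → ∫⁻ x, ENNReal.ofReal (‖fderiv ℝ v x‖ ^ n) ≤ 1 →
        ∫⁻ x, ENNReal.ofReal (weightedPower P n n (n + j * (n / (n - 1))) v x) ≤ C := by
      intro j
      induction j with
      | zero => simpa using ⟨C₀, hC₀⟩
      | succ j ih =>
        obtain ⟨B, hB⟩ := ih
        obtain ⟨C, hC⟩ := exists_lintegral_weightedPower_critical_step hP1 hae hn.symm hp1
          (q := n + j * (n / (n - 1))) (by linarith [show 0 ≤ j * (n / (n - 1)) by positivity])
          C₀ B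
        refine ⟨C, fun v hv hc hvP h1 => ?_⟩
        have := hC v hv hc hvP h1 (hC₀ v hv hc hvP h1) (hB v hv hc hvP h1)
        push_cast
        convert this using 5
        ring
    -- Every step gains the fixed amount n / (n - 1), so finitely many of them pass q.
    obtain ⟨j, hj⟩ := exists_nat_ge ((q - n) / (n / (n - 1)))
    refine hinterp _ ?_ (hind j)
    rw [div_le_iff₀ hstep] at hj
    linarith
  · obtain ⟨M, hM⟩ := exists_rpow_mul_abs_le_of_vanishing hP hp1.le hnp
    refine ⟨M ^ (q - p) * C₀, fun v hv hc hvP h1 => ?_⟩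
    have hpt : ∀ x, P x ≠ 0 → ENNReal.ofReal (weightedPower P n p q v x) ≤
        ((M ^ (q - p) : ℝ≥0) : ℝ≥0∞) * ENNReal.ofReal (weightedPower P n p p v x) := by
      intro x hx
      have hf := hM v hv hvP h1 x hx
      have hf0 : 0 ≤ ‖P x‖ ^ (-(1 - n / p)) * |v x| := by positivity
      rw [← ENNReal.ofReal_coe_nnreal, ← ENNReal.ofReal_mul (NNReal.coe_nonneg _)]
      refine ENNReal.ofReal_le_ofReal ?_
      rw [weightedPower_eq P n p _ v hx, weightedPower_eq P n p _ v hx, NNReal.coe_rpow]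
      set f := ‖P x‖ ^ (-(1 - n / p)) * |v x|
      have e : f ^ q = f ^ p * f ^ (q - p) := by
        rw [← Real.rpow_add_of_nonneg hf0 hp0.le (sub_nonneg.2 hpq)]
        ring_nf
      rw [e]
      have : f ^ (q - p) ≤ (M : ℝ) ^ (q - p) := Real.rpow_le_rpow hf0 hf (sub_nonneg.2 hpq)
      calc _ = f ^ (q - p) * (‖P x‖ ^ (-n) * f ^ p) := by ring
        _ ≤ _ := by gcongr
    calc _ ≤ ∫⁻ x, ((M ^ (q - p) : ℝ≥0) : ℝ≥0∞) * ENNReal.ofReal (weightedPower P n p p v x) :=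
          lintegral_mono_ae (hae.mono hpt)
      _ ≤ _ := by
          rw [lintegral_const_mul' _ _ ENNReal.coe_ne_top, ENNReal.coe_mul]
          gcongr
          exact hC₀ v hv hc hvP h1

end

/-! ### Rotations in a coordinate plane -/

section

variable {E : Type*} [NormedAddCommGroup E] [InnerProductSpace ℝ E]

/-- Rotation by the angle `t` in the plane spanned by the orthonormal vectors `e` and `f`. -/
noncomputable def planeRotation (e f : E) (t : ℝ) (x : E) : E :=
  x + (Real.cos t - 1) • (inner ℝ e x • e + inner ℝ f x • f) +
    Real.sin t • (inner ℝ e x • f - inner ℝ f x • e)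

theorem planeRotation_zero (e f x : E) : planeRotation e f 0 x = x := by
  simp [planeRotation]

theorem inner_planeRotation_pi {e f : E} (he : ‖e‖ = 1) (hef : inner ℝ e f = 0) (x : E) :
    inner ℝ e (planeRotation e f Real.pi x) = -inner ℝ e x := by
  simp only [planeRotation, Real.cos_pi, Real.sin_pi, inner_add_right, inner_smul_right, hef,
    real_inner_self_eq_norm_sq, he]
  ring

theorem planeRotation_add (e f : E) (t : ℝ) (x y : E) :
    planeRotation e f t (x + y) = planeRotation e f t x + planeRotation e f t y := by
  simp only [planeRotation, inner_add_right]
  module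

theorem planeRotation_smul (e f : E) (t c : ℝ) (x : E) :
    planeRotation e f t (c • x) = c • planeRotation e f t x := by
  simp only [planeRotation, inner_smul_right]
  module

theorem norm_planeRotation {e f : E} (he : ‖e‖ = 1) (hf : ‖f‖ = 1) (hef : inner ℝ e f = 0)
    (t : ℝ) (x : E) : ‖planeRotation e f t x‖ = ‖x‖ := by
  rw [← sq_eq_sq₀ (norm_nonneg _) (norm_nonneg _), ← real_inner_self_eq_norm_sq,
    ← real_inner_self_eq_norm_sq]
  have hfe : inner ℝ f e = 0 := by rw [real_inner_comm, hef]
  simp only [planeRotation, inner_add_left, inner_add_right, inner_sub_left, inner_sub_right,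
    real_inner_smul_left, inner_smul_right, hef, hfe, real_inner_self_eq_norm_sq e,
    real_inner_self_eq_norm_sq f, he, hf, real_inner_comm e x, real_inner_comm f x]
  linear_combination (inner ℝ e x ^ 2 + inner ℝ f x ^ 2) * Real.sin_sq_add_cos_sq t

theorem continuous_planeRotation (e f : E) :
    Continuous fun z : E × ℝ => planeRotation e f z.2 z.1 := by
  unfold planeRotation
  fun_prop

theorem hasDerivAt_planeRotation (e f x : E) (t : ℝ) :
    HasDerivAt (fun t => planeRotation e f t x)
      (-Real.sin t • (inner ℝ e x • e + inner ℝ f x • f) +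
        Real.cos t • (inner ℝ e x • f - inner ℝ f x • e)) t := by
  unfold planeRotation
  exact ((((Real.hasDerivAt_cos t).sub_const 1).smul_const _).const_add x).add
    ((Real.hasDerivAt_sin t).smul_const _)

/-- The speed is the length of the component of x in the plane of e and f; Bessel's inequality
bounds it. -/
theorem norm_deriv_planeRotation_le {e f : E} (he : ‖e‖ = 1) (hf : ‖f‖ = 1)
    (hef : inner ℝ e f = 0) (t : ℝ) (x : E) :
    ‖-Real.sin t • (inner ℝ e x • e + inner ℝ f x • f) +
      Real.cos t • (inner ℝ e x • f - inner ℝ f x • e)‖ ≤ ‖x‖ := by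
  rw [← sq_le_sq₀ (norm_nonneg _) (norm_nonneg _), ← real_inner_self_eq_norm_sq,
    ← real_inner_self_eq_norm_sq]
  have hfe : inner ℝ f e = 0 := by rw [real_inner_comm, hef]
  have h : 0 ≤ inner ℝ (x - (inner ℝ e x • e + inner ℝ f x • f))
      (x - (inner ℝ e x • e + inner ℝ f x • f)) := real_inner_self_nonneg
  simp only [inner_add_left, inner_add_right, inner_sub_left, inner_sub_right,
    real_inner_smul_left, inner_smul_right, hef, hfe, real_inner_self_eq_norm_sq e,
    real_inner_self_eq_norm_sq f, he, hf, real_inner_comm e x, real_inner_comm f x] at h ⊢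
  have hsc := Real.sin_sq_add_cos_sq t
  have : (inner ℝ e x ^ 2 + inner ℝ f x ^ 2) * (Real.sin t ^ 2 + Real.cos t ^ 2) ≤ inner ℝ x x := by
    rw [hsc]; linarith
  linarith

end

/-! ### Functions vanishing near a slit: case (c) -/

section

variable {E : Type*} [NormedAddCommGroup E] [InnerProductSpace ℝ E] [FiniteDimensional ℝ E]

/-- Removing the direction of a unit vector in its range lowers the rank of a projection by one. -/
theorem finrank_range_sub_rankOne {P : E →L[ℝ] E} (hP : ∀ x, P (P x) = P x)
    (hPs : ∀ x y, inner ℝ (P x) y = inner ℝ x (P y)) {e : E} (he : ‖e‖ = 1) (hPe : P e = e) :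
    Module.finrank ℝ (LinearMap.range
      ((P - (innerSL ℝ e).smulRight e : E →L[ℝ] E) : E →ₗ[ℝ] E)) + 1 =
      Module.finrank ℝ (LinearMap.range (P : E →ₗ[ℝ] E)) := by
  -- The rank of a projection is its trace, and the trace is additive.
  have htr : ∀ Q : E →L[ℝ] E, (∀ x, Q (Q x) = Q x) → LinearMap.trace ℝ E (Q : E →ₗ[ℝ] E) =
      Module.finrank ℝ (LinearMap.range (Q : E →ₗ[ℝ] E)) := fun Q hQ =>
    LinearMap.IsProj.trace ⟨fun x => ⟨x, rfl⟩, by rintro _ ⟨y, rfl⟩; exact hQ y⟩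
  have h1 := htr P hP
  have h2 := htr (P - (innerSL ℝ e).smulRight e) (fun x => by
    have : inner ℝ e (P x) = inner ℝ e x := by rw [← hPs, hPe]
    simp [hP, hPe, this, inner_sub_right, inner_smul_right, he])
  have h3 : LinearMap.trace ℝ E (((innerSL ℝ e).smulRight e : E →L[ℝ] E) : E →ₗ[ℝ] E) = 1 := by
    have : (((innerSL ℝ e).smulRight e : E →L[ℝ] E) : E →ₗ[ℝ] E) =
        ((innerSL ℝ e : E →L[ℝ] ℝ) : E →ₗ[ℝ] ℝ).smulRight e := by ext; simp
    rw [this, LinearMap.trace_smulRight]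
    simp [he]
  rw [ContinuousLinearMap.toLinearMap_sub, map_sub, h3, h1] at h2
  have : (Module.finrank ℝ (LinearMap.range
      ((P - (innerSL ℝ e).smulRight e : E →L[ℝ] E) : E →ₗ[ℝ] E)) : ℝ) + 1 =
      Module.finrank ℝ (LinearMap.range (P : E →ₗ[ℝ] E)) := by
    rw [ContinuousLinearMap.toLinearMap_sub, ← h2]; ring
  exact_mod_cast this

variable [MeasurableSpace E] [BorelSpace E]

theorem measurePreserving_planeRotation {e f : E} (he : ‖e‖ = 1) (hf : ‖f‖ = 1)
    (hef : inner ℝ e f = 0) (t : ℝ) : MeasurePreserving (planeRotation e f t) := by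
  let L : E →ₗᵢ[ℝ] E :=
    { toFun := planeRotation e f t
      map_add' := planeRotation_add e f t
      map_smul' := fun c x => planeRotation_smul e f t c x
      norm_map' := norm_planeRotation he hf hef t }
  exact (L.toLinearIsometryEquiv rfl).measurePreserving

/-- The `Lₚ` Hardy inequality with `p = rank P` for functions that vanish near a half-space
`{x | P x = t • e, t ≥ 0}`. -/
theorem exists_lintegral_weightedPower_le_of_slit {P : E →L[ℝ] E} (hP : ∀ x, P (P x) = P x)
    (hPs : ∀ x y, inner ℝ (P x) y = inner ℝ x (P y)) {k : ℕ}
    (hk : Module.finrank ℝ (LinearMap.range (P : E →ₗ[ℝ] E)) = k) (hk1 : 1 < k)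
    {e f : E} (he : ‖e‖ = 1) (hf : ‖f‖ = 1) (hef : inner ℝ e f = 0) (hPe : P e = e)
    (hPf : P f = f) (n : ℝ) :
    ∃ C : ℝ≥0, ∀ v : E → ℝ, ContDiff ℝ 1 v → HasCompactSupport v →
      (∀ x ∈ tsupport v, 0 ≤ inner ℝ e x → P x ≠ inner ℝ e x • e) →
      ∫⁻ x, ENNReal.ofReal (‖fderiv ℝ v x‖ ^ (k : ℝ)) ≤ 1 →
      ∫⁻ x, ENNReal.ofReal (weightedPower P n k k v x) ≤ C := by
  set p : ℝ := (k : ℝ) with hp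
  have hp1 : 1 < p := by rw [hp]; exact_mod_cast hk1
  have hp0 : 0 < p := by linarith
  have hae := ae_map_ne_zero hk (by omega)
  -- Rank k - 1 < p makes Hardy's inequality available again. Within ⟨e, x⟩ ≥ 0 the kernel of Q is
  -- the slit, and dilations along Q preserve that half-space because Q x ⟂ e.
  set Q : E →L[ℝ] E := P - (innerSL ℝ e).smulRight e with hQ
  have hQx : ∀ x, Q x = P x - inner ℝ e x • e := fun x => by simp [hQ]
  have heP : ∀ x, inner ℝ e (P x) = inner ℝ e x := fun x => by rw [← hPs, hPe]
  have hfP : ∀ x, inner ℝ f (P x) = inner ℝ f x := fun x => by rw [← hPs, hPf]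
  have heQ : ∀ x, inner ℝ e (Q x) = 0 := fun x => by
    simp [hQx, inner_sub_right, inner_smul_right, heP, he]
  have hQQ : ∀ x, Q (Q x) = Q x := fun x => by
    rw [hQx (Q x), heQ, zero_smul, sub_zero, hQx, map_sub, map_smul, hP, hPe]
  have hQk : Module.finrank ℝ (LinearMap.range (Q : E →ₗ[ℝ] E)) = k - 1 := by
    have := finrank_range_sub_rankOne hP hPs he hPe
    rw [hk] at this
    exact Nat.eq_sub_of_add_eq this
  have hQP : ∀ x, ‖Q x‖ ≤ ‖P x‖ := fun x => by
    have h2 : inner ℝ (P x) e = inner ℝ e x := by rw [hPs, hPe, real_inner_comm]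
    rw [← sq_le_sq₀ (norm_nonneg _) (norm_nonneg _), hQx, norm_sub_sq_real, norm_smul, he,
      inner_smul_right, h2, mul_one, Real.norm_eq_abs, sq_abs]
    nlinarith [sq_nonneg (inner ℝ e x)]
  have hQae := ae_map_ne_zero hQk (by omega)
  have hk' : ((k - 1 : ℕ) : ℝ) < p := by
    rw [Nat.cast_sub hk1.le]; simp [hp]
  set S : Set E := {x | 0 ≤ inner ℝ e x} with hS
  have hSc : IsClosed S := isClosed_le continuous_const (continuous_const.inner continuous_id)
  obtain ⟨C₁, hC₁⟩ := exists_setLIntegral_weightedPower_le_of_vanishing hQQ hQk (by omega) n hk' hp1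
    hSc (fun x hx t _ => by
      simp only [hS, mem_ofPred_eq] at hx ⊢
      rwa [inner_add_right, inner_smul_right, heQ, mul_zero, add_zero])
  have hpp := (Real.HolderConjugate.conjExponent hp1).symm
  have ha : n + p * (1 - n / p) = p := by field_simp; ring
  have hs : (p - 1) * p.conjExponent = p := by
    change (p - 1) * (p / (p - 1)) = p
    field_simp [(by linarith : p - 1 ≠ 0)]
  obtain ⟨C₂, hC₂⟩ := exists_lintegral_weightedPower_le_quarter (E := E) n hpp p
    (Real.pi.toNNReal * p.toNNReal)
  refine ⟨2 * (2 * C₁ + C₂), fun v hv hc hvS h1 => ?_⟩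
  have hC₂' := hC₂ P univ v hae hv h1
  rw [hs, ha] at hC₂'
  simp only [setLIntegral_univ] at hC₂'
  set I : E → ℝ≥0∞ := fun x => ENNReal.ofReal (weightedPower P n p p v x) with hI
  have hIm : Measurable I := (measurable_weightedPower P n p p hv.continuous).ennreal_ofReal
  have hIe : ∀ x, weightedPower P n p p v x = ‖P x‖ ^ (-p) * |v x| ^ p := fun x => by
    rw [weightedPower, ha]
  have hIS : ∫⁻ x in S, I x ≤ C₁ := by
    refine le_trans (lintegral_mono_ae ((ae_restrict_of_ae hQae).mono fun x hx => ?_))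
      (hC₁ v hv hc (fun x hx hxS h0 => hvS x hx hxS (sub_eq_zero.1 (hQx x ▸ h0))) h1)
    refine ENNReal.ofReal_le_ofReal ?_
    rw [hIe, weightedPower, ha]
    gcongr ?_ * _
    exact Real.rpow_le_rpow_of_nonpos (norm_pos_iff.2 hx) (hQP x) (by linarith)
  -- The slit contains ker P, as its edge ⟨e, x⟩ = 0, so v vanishes near ker P.
  have hIt : ∫⁻ x, I x ≠ ⊤ := by
    have := lintegral_weightedPower_lt_top_of_ne_zero P n p hp0 hv.continuous hc isClosed_univ
      (fun x hx _ h0 => by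
        have h2 : inner ℝ e x = 0 := by rw [← heP, h0, inner_zero_right]
        exact hvS x hx h2.ge (by rw [h0, h2, zero_smul]))
    rw [setLIntegral_univ] at this
    exact this.ne
  obtain ⟨u, hu, huv, hdu⟩ := exists_contDiff_abs_rpow hv hp1.le
  set R := planeRotation e f with hR
  have hRm : ∀ t, MeasurePreserving (R t) := measurePreserving_planeRotation he hf hef
  have hPR : ∀ t x, ‖P (R t x)‖ = ‖P x‖ := fun t x => by
    have : P (R t x) = R t (P x) := by
      simp only [hR, planeRotation, map_add, map_sub, map_smul, hPe, hPf, heP, hfP]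
    rw [this, norm_planeRotation he hf hef]
  set W : E → ℝ≥0∞ := fun x => ENNReal.ofReal (‖P x‖ ^ (-p)) with hW
  have hWR : ∀ t x, W (R t x) = W x := fun t x => by simp only [hW, hPR]
  have hWu : ∀ x, W x * ‖u x‖ₑ = I x := fun x => by
    rw [hI, hW]
    simp only
    rw [hIe, ENNReal.ofReal_mul (by positivity), ← huv, ← Real.enorm_eq_ofReal (abs_nonneg _),
      Real.enorm_abs]
  set F : E → ℝ≥0∞ := fun x => W x * (‖P x‖ₑ * ‖fderiv ℝ u x‖ₑ) with hF
  have hWm : Measurable W := (P.continuous.norm.measurable.pow_const _).ennreal_ofReal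
  have hFm : Measurable F := hWm.mul (P.continuous.enorm.measurable.mul
    (hu.continuous_fderiv one_ne_zero).enorm.measurable)
  have hFR : Measurable fun z : E × ℝ => F (R z.2 z.1) :=
    hFm.comp (continuous_planeRotation e f).measurable
  have hFle : ∫⁻ x, F x ≤ p.toNNReal *
      ∫⁻ x, ENNReal.ofReal (‖P x‖ ^ (1 - p) * (|v x| ^ (p - 1) * ‖fderiv ℝ v x‖)) := by
    rw [← lintegral_const_mul' _ _ ENNReal.coe_ne_top]
    refine lintegral_mono_ae (hae.mono fun x hx => ?_)
    have hy := norm_pos_iff.2 hx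
    simp only [hF, hW]
    rw [← ofReal_norm, ← ofReal_norm, ← ENNReal.ofReal_mul (by positivity),
      ← ENNReal.ofReal_mul (by positivity), ← ENNReal.ofReal, ← ENNReal.ofReal_mul hp0.le]
    refine ENNReal.ofReal_le_ofReal ?_
    have e3 : ‖P x‖ ^ (1 - p) = ‖P x‖ ^ (-p) * ‖P x‖ := by
      rw [← Real.rpow_add_one hy.ne']; ring_nf
    calc ‖P x‖ ^ (-p) * (‖P x‖ * ‖fderiv ℝ u x‖)
        ≤ ‖P x‖ ^ (-p) * (‖P x‖ * (p * (|v x| ^ (p - 1) * ‖fderiv ℝ v x‖))) := by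
          gcongr; exact hdu x
      _ = _ := by rw [e3]; ring
  -- The half-turn maps Sᶜ into S. The rotations preserve the measure and ‖P x‖, and move x, in the
  -- plane of e and f, with speed at most ‖P x‖; so the increment of u costs π times the right side
  -- of Hardy's inequality, part of which is absorbed.
  have hISc : ∫⁻ x in Sᶜ, I x ≤ C₁ + (4⁻¹ * (∫⁻ x, I x) + C₂) := by
    have hpt : ∀ x ∈ Sᶜ, I x ≤ S.indicator I (R Real.pi x) +
        ∫⁻ t in Icc 0 Real.pi, F (R t x) := by
      intro x hx
      have hRS : R Real.pi x ∈ S := by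
        simp only [hS, mem_compl_iff, mem_ofPred_eq, not_le] at hx ⊢
        rw [hR, inner_planeRotation_pi he hef]
        linarith
      have hcurve := enorm_sub_le_lintegral_fderiv hu (hasDerivAt_planeRotation e f x)
        (by fun_prop) Real.pi_pos.le
      rw [planeRotation_zero] at hcurve
      rw [indicator_of_mem hRS, ← hWu, ← hWu, hWR]
      have h2 : ‖u x‖ₑ ≤ ‖u (R Real.pi x)‖ₑ + ‖u (R Real.pi x) - u x‖ₑ := by
        have : u x = u (R Real.pi x) - (u (R Real.pi x) - u x) := by ring
        conv_lhs => rw [this]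
        exact enorm_sub_le
      calc W x * ‖u x‖ₑ ≤ W x * (‖u (R Real.pi x)‖ₑ + ‖u (R Real.pi x) - u x‖ₑ) := by gcongr
        _ = W x * ‖u (R Real.pi x)‖ₑ + W x * ‖u (R Real.pi x) - u x‖ₑ := mul_add _ _ _
        _ ≤ _ := by
            gcongr
            refine (mul_le_mul_right hcurve _).trans ((lintegral_const_mul_le _ _).trans ?_)
            refine lintegral_mono fun t => ?_
            simp only [hF, hWR]
            gcongr
            rw [← ofReal_norm, ← ofReal_norm, hPR]
            refine ENNReal.ofReal_le_ofReal ?_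
            have := norm_deriv_planeRotation_le he hf hef t (P x)
            rwa [heP, hfP] at this
    calc ∫⁻ x in Sᶜ, I x
        ≤ ∫⁻ x in Sᶜ, (S.indicator I (R Real.pi x) + ∫⁻ t in Icc 0 Real.pi, F (R t x)) :=
          setLIntegral_mono' hSc.measurableSet.compl hpt
      _ ≤ ∫⁻ x, (S.indicator I (R Real.pi x) + ∫⁻ t in Icc 0 Real.pi, F (R t x)) :=
          setLIntegral_le_lintegral _ _
      _ = (∫⁻ x in S, I x) + ∫⁻ t in Icc 0 Real.pi, ∫⁻ x, F x := by
          have hSI := hIm.indicator hSc.measurableSet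
          rw [lintegral_add_left (f := fun x => S.indicator I (R Real.pi x))
              (hSI.comp (hRm _).measurable),
            lintegral_lintegral_swap hFR.aemeasurable, (hRm _).lintegral_comp hSI,
            lintegral_indicator hSc.measurableSet]
          congr 2
          ext t
          exact (hRm t).lintegral_comp hFm
      _ ≤ _ := by
          refine add_le_add hIS (le_trans ?_ hC₂')
          rw [setLIntegral_const, Real.volume_Icc, sub_zero, mul_comm]
          push_cast
          rw [mul_assoc]
          exact mul_le_mul_right hFle _
  push_cast
  refine le_two_mul_of_le_half_add hIt ?_
  calc ∫⁻ x, I x = (∫⁻ x in S, I x) + ∫⁻ x in Sᶜ, I x :=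
        (lintegral_add_compl I hSc.measurableSet).symm
    _ ≤ C₁ + (C₁ + (4⁻¹ * (∫⁻ x, I x) + C₂)) := add_le_add hIS hISc
    _ = 4⁻¹ * (∫⁻ x, I x) + (2 * C₁ + C₂) := by ring
    _ ≤ _ := by
        gcongr
        norm_num

end

/-! ### The coordinate projection onto the y variables -/

section Coordinates

variable {m n : ℕ}

/-- The projection `x ↦ y` as a linear map. -/
def yPartₗ (h : m ≤ n) : EuclideanSpace ℝ (Fin n) →ₗ[ℝ] EuclideanSpace ℝ (Fin m) where
  toFun := yPart h
  map_add' x y := by ext; simp [yPart]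
  map_smul' c x := by ext; simp [yPart]

/-- The inclusion `y ↦ (y; 0)`. -/
def yInclusion (_h : m ≤ n) : EuclideanSpace ℝ (Fin m) →ₗ[ℝ] EuclideanSpace ℝ (Fin n) where
  toFun y := WithLp.toLp 2 fun i => if hi : (i : ℕ) < m then y ⟨i, hi⟩ else 0
  map_add' x y := by ext i; by_cases hi : (i : ℕ) < m <;> simp [hi]
  map_smul' c x := by ext i; by_cases hi : (i : ℕ) < m <;> simp [hi]

theorem yPart_yInclusion (h : m ≤ n) (y : EuclideanSpace ℝ (Fin m)) :
    yPart h (yInclusion h y) = y := by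
  ext i; simp [yPart, yInclusion]

theorem inner_yInclusion_left (h : m ≤ n) (y : EuclideanSpace ℝ (Fin m))
    (x : EuclideanSpace ℝ (Fin n)) : inner ℝ (yInclusion h y) x = inner ℝ y (yPart h x) := by
  obtain ⟨d, rfl⟩ := Nat.exists_eq_add_of_le h
  simp only [PiLp.inner_apply, Fin.sum_univ_add]
  simp [yInclusion, yPart, Fin.castLE, Fin.castAdd]

theorem norm_yInclusion (h : m ≤ n) (y : EuclideanSpace ℝ (Fin m)) : ‖yInclusion h y‖ = ‖y‖ := by
  rw [← sq_eq_sq₀ (norm_nonneg _) (norm_nonneg _), ← real_inner_self_eq_norm_sq,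
    ← real_inner_self_eq_norm_sq, inner_yInclusion_left, yPart_yInclusion]

/-- The orthogonal projection `x ↦ (y; 0)`. -/
noncomputable def yProj (h : m ≤ n) : EuclideanSpace ℝ (Fin n) →L[ℝ] EuclideanSpace ℝ (Fin n) :=
  (yInclusion h ∘ₗ yPartₗ h).toContinuousLinearMap

theorem yProj_apply (h : m ≤ n) (x : EuclideanSpace ℝ (Fin n)) :
    yProj h x = yInclusion h (yPart h x) := rfl

theorem norm_yProj (h : m ≤ n) (x : EuclideanSpace ℝ (Fin n)) : ‖yProj h x‖ = ‖yPart h x‖ := by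
  rw [yProj_apply, norm_yInclusion]

theorem yProj_yProj (h : m ≤ n) (x : EuclideanSpace ℝ (Fin n)) :
    yProj h (yProj h x) = yProj h x := by
  simp only [yProj_apply, yPart_yInclusion]

theorem inner_yProj_left (h : m ≤ n) (x y : EuclideanSpace ℝ (Fin n)) :
    inner ℝ (yProj h x) y = inner ℝ x (yProj h y) := by
  rw [yProj_apply, yProj_apply, inner_yInclusion_left,
    real_inner_comm (yInclusion h (yPart h y)) x, inner_yInclusion_left,
    real_inner_comm]

theorem norm_yProj_le (h : m ≤ n) (x : EuclideanSpace ℝ (Fin n)) : ‖yProj h x‖ ≤ ‖x‖ := by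
  have h1 : ‖yProj h x‖ ^ 2 ≤ ‖x‖ * ‖yProj h x‖ := by
    rw [← real_inner_self_eq_norm_sq, inner_yProj_left, yProj_yProj]
    exact real_inner_le_norm _ _
  rcases (norm_nonneg (yProj h x)).eq_or_lt with h0 | h0
  · rw [← h0]; exact norm_nonneg _
  · nlinarith

theorem finrank_range_yProj (h : m ≤ n) :
    Module.finrank ℝ (LinearMap.range
      (yProj h : EuclideanSpace ℝ (Fin n) →ₗ[ℝ] EuclideanSpace ℝ (Fin n))) = m := by
  have hs : Function.Surjective (yPartₗ h) := fun y => ⟨yInclusion h y, yPart_yInclusion h y⟩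
  have hi : Function.Injective (yInclusion h) := fun a b hab => by
    rw [← yPart_yInclusion h a, hab, yPart_yInclusion]
  have e : (yProj h : EuclideanSpace ℝ (Fin n) →ₗ[ℝ] EuclideanSpace ℝ (Fin n)) =
      yInclusion h ∘ₗ yPartₗ h := rfl
  rw [e, LinearMap.range_comp_of_range_eq_top _ (LinearMap.range_eq_top.2 hs),
    LinearMap.finrank_range_of_inj hi, finrank_euclideanSpace_fin]

theorem measurable_norm_yPart (h : m ≤ n) : Measurable fun x => ‖yPart h x‖ := by
  simp_rw [← norm_yProj]
  exact (yProj h).continuous.norm.measurable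

end Coordinates

/-! ### From normalized test functions to the homogeneous Sobolev space -/

section Closure

variable {n : ℕ} {Ω : Set (EuclideanSpace ℝ (Fin n))}

theorem norm_gradient (φ : EuclideanSpace ℝ (Fin n) → ℝ) (x : EuclideanSpace ℝ (Fin n)) :
    ‖∇ φ x‖ = ‖fderiv ℝ φ x‖ :=
  (InnerProductSpace.toDual ℝ (EuclideanSpace ℝ (Fin n))).symm.norm_map _

theorem continuous_gradient {φ : EuclideanSpace ℝ (Fin n) → ℝ} (hφ : ContDiff ℝ 1 φ) :
    Continuous (∇ φ) :=
  (InnerProductSpace.toDual ℝ (EuclideanSpace ℝ (Fin n))).symm.continuous.comp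
    (hφ.continuous_fderiv one_ne_zero)

theorem eLpNorm_fderiv_eq_eLpNorm_gradient {φ : EuclideanSpace ℝ (Fin n) → ℝ}
    (hφ : IsTestFunction Ω φ) (p : ℝ≥0∞) :
    eLpNorm (fderiv ℝ φ) p volume = eLpNorm (∇ φ) p (volume.restrict Ω) := by
  have hsupp : Function.support (fun x => ‖fderiv ℝ φ x‖) ⊆ Ω := fun x hx =>
    hφ.2.2 (support_fderiv_subset ℝ (norm_ne_zero_iff.1 hx))
  calc eLpNorm (fderiv ℝ φ) p volume = eLpNorm (fun x => ‖fderiv ℝ φ x‖) p volume :=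
        (eLpNorm_norm _).symm
    _ = eLpNorm (fun x => ‖fderiv ℝ φ x‖) p (volume.restrict Ω) :=
        (eLpNorm_restrict_eq_of_support_subset hsupp).symm
    _ = _ := eLpNorm_congr_norm_ae (Eventually.of_forall fun x => by
        rw [norm_norm, norm_gradient])

/-- The fundamental lemma of the calculus of variations. It identifies an arbitrary weak gradient
with the limit of the approximating gradients. -/
theorem HasWeakGradient.ae_eq (hΩ : IsOpen Ω) {v : EuclideanSpace ℝ (Fin n) → ℝ}
    {G G' : EuclideanSpace ℝ (Fin n) → EuclideanSpace ℝ (Fin n)} (hG : HasWeakGradient Ω v G)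
    (hG' : HasWeakGradient Ω v G') : G =ᵐ[volume.restrict Ω] G' := by
  have hint : ∀ {H : EuclideanSpace ℝ (Fin n) → EuclideanSpace ℝ (Fin n)},
      LocallyIntegrableOn H Ω volume → ∀ g : EuclideanSpace ℝ (Fin n) → ℝ, IsTestFunction Ω g →
      IntegrableOn (fun x => g x • H x) Ω volume := by
    intro H hH g hg
    have hK : IsCompact (tsupport g) := hg.2.1
    have h1 : IntegrableOn (fun x => g x • H x) (tsupport g) volume :=
      (hH.integrableOn_compact_subset hg.2.2 hK).continuousOn_smul hg.1.continuous.continuousOn hK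
    refine h1.of_forall_sdiff_eq_zero hΩ.measurableSet fun x hx => ?_
    rw [image_eq_zero_of_notMem_tsupport hx.2, zero_smul]
  have key := hΩ.ae_eq_zero_of_integral_contDiff_smul_eq_zero (μ := volume)
    (f := fun x => G x - G' x) (hG.2.1.sub hG'.2.1) (fun g hg1 hg2 hg3 => by
      have hg : IsTestFunction Ω g := ⟨hg1, hg2, hg3⟩
      rw [← setIntegral_eq_integral_of_forall_compl_eq_zero (s := Ω) (fun x hx => by
        rw [image_eq_zero_of_notMem_tsupport (fun h => hx (hg3 h)), zero_smul])]
      simp only [smul_sub]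
      rw [integral_sub (hint hG.2.1 g hg) (hint hG'.2.1 g hg)]
      have e1 := hG.2.2 g hg
      have e2 := hG'.2.2 g hg
      rw [e1, neg_inj] at e2
      rw [e2, sub_self])
  rw [Filter.EventuallyEq, ae_restrict_iff' hΩ.measurableSet]
  filter_upwards [key] with x hx hxΩ
  exact sub_eq_zero.1 (hx hxΩ)

/-- An inequality for test functions normalized by their gradient extends to all of them. -/
theorem eLpNorm_mul_le_of_normalized {w : EuclideanSpace ℝ (Fin n) → ℝ} {p : ℝ} (hp : 1 ≤ p)
    {q : ℝ≥0∞} {C : ℝ≥0}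
    (h : ∀ φ : EuclideanSpace ℝ (Fin n) → ℝ, IsTestFunction Ω φ →
      ∫⁻ x, ENNReal.ofReal (‖fderiv ℝ φ x‖ ^ p) ≤ 1 →
      eLpNorm (fun x => w x * φ x) q volume ≤ C)
    {φ : EuclideanSpace ℝ (Fin n) → ℝ} (hφ : IsTestFunction Ω φ) :
    eLpNorm (fun x => w x * φ x) q volume ≤
      C * eLpNorm (∇ φ) (ENNReal.ofReal p) (volume.restrict Ω) := by
  have hp0 : 0 < p := by linarith
  rw [← eLpNorm_fderiv_eq_eLpNorm_gradient hφ]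
  have hφ1 : ContDiff ℝ 1 φ := hφ.1.of_le (by exact_mod_cast le_top)
  set g := eLpNorm (fderiv ℝ φ) (ENNReal.ofReal p) volume with hg
  have hgt : g ≠ ⊤ := ((hφ1.continuous_fderiv one_ne_zero).memLp_of_hasCompactSupport
    (hφ.2.1.fderiv ℝ)).2.ne
  -- Dividing φ by any c ≥ g with c > 0, instead of by g itself, avoids a separate case for g = 0; c
  -- = g + δ is then brought down to g.
  have main : ∀ c : ℝ≥0, 0 < c → g ≤ c → eLpNorm (fun x => w x * φ x) q volume ≤ C * c := by
    intro c hc hgc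
    have hc' : (c : ℝ) ≠ 0 := by exact_mod_cast hc.ne'
    set ψ : EuclideanSpace ℝ (Fin n) → ℝ := fun x => (c : ℝ)⁻¹ • φ x with hψ
    have hsupp : Function.support ψ ⊆ Function.support φ := by
      intro x hx h0
      exact hx (by simp [hψ, h0])
    have hψt : IsTestFunction Ω ψ := ⟨hφ.1.const_smul _, hφ.2.1.mono hsupp,
      (closure_mono hsupp).trans hφ.2.2⟩
    have hd : fderiv ℝ ψ = (c : ℝ)⁻¹ • fderiv ℝ φ := by
      ext1 x
      exact fderiv_fun_const_smul (hφ1.differentiable one_ne_zero x) _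
    have hcinv : ‖(c : ℝ)⁻¹‖ₑ = (c : ℝ≥0∞)⁻¹ := by
      rw [enorm_inv hc', Real.enorm_eq_ofReal c.coe_nonneg, ENNReal.ofReal_coe_nnreal]
    have hcc : (c : ℝ≥0∞)⁻¹ * c = 1 :=
      ENNReal.inv_mul_cancel (by exact_mod_cast hc.ne') ENNReal.coe_ne_top
    have hn : eLpNorm (fderiv ℝ ψ) (ENNReal.ofReal p) volume = (c : ℝ≥0∞)⁻¹ * g := by
      rw [hd, hg, ← hcinv]
      exact eLpNorm_const_smul (c : ℝ)⁻¹ (fderiv ℝ φ) (ENNReal.ofReal p) volume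
    have h1 := h ψ hψt (by
      rw [lintegral_ofReal_norm_rpow _ _ hp0, hn]
      refine ENNReal.rpow_le_one (le_trans ?_ hcc.le) hp0.le
      gcongr)
    have e : (fun x => w x * ψ x) = (c : ℝ)⁻¹ • fun x => w x * φ x := by
      ext x; simp only [hψ, Pi.smul_apply, smul_eq_mul]; ring
    rw [e, eLpNorm_const_smul, hcinv] at h1
    calc _ = (c : ℝ≥0∞) * ((c : ℝ≥0∞)⁻¹ * eLpNorm (fun x => w x * φ x) q volume) := by
          rw [← mul_assoc, mul_comm (c : ℝ≥0∞), hcc, one_mul]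
      _ ≤ (c : ℝ≥0∞) * C := by gcongr
      _ = _ := mul_comm _ _
  refine ENNReal.le_of_forall_pos_le_add fun ε hε _ => ?_
  set δ : ℝ≥0 := ε / (C + 1) with hδ
  have hδ0 : 0 < δ := by positivity
  have h2 := main (g.toNNReal + δ) (by positivity) (by
    rw [ENNReal.coe_add, ENNReal.coe_toNNReal hgt]; exact le_self_add)
  rw [ENNReal.coe_add, ENNReal.coe_toNNReal hgt, mul_add] at h2
  refine h2.trans ?_
  gcongr
  have : C * δ ≤ ε := by
    rw [hδ, ← mul_div_assoc]
    exact NNReal.div_le_of_le_mul (by rw [mul_comm]; gcongr; exact le_self_add)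
  exact_mod_cast this

/-- An inequality for test functions extends to their closure. -/
theorem eLpNorm_mul_le_of_forall_isTestFunction (hΩ : IsOpen Ω)
    {w : EuclideanSpace ℝ (Fin n) → ℝ} (hw : Measurable w) {p : ℝ} (hp : 1 ≤ p) {q : ℝ≥0∞}
    {C : ℝ≥0}
    (h : ∀ φ : EuclideanSpace ℝ (Fin n) → ℝ, IsTestFunction Ω φ →
      eLpNorm (fun x => w x * φ x) q volume ≤
        C * eLpNorm (∇ φ) (ENNReal.ofReal p) (volume.restrict Ω))
    {v : EuclideanSpace ℝ (Fin n) → ℝ} (hv : MemHomSobolev Ω p v)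
    {G : EuclideanSpace ℝ (Fin n) → EuclideanSpace ℝ (Fin n)} (hG : HasWeakGradient Ω v G) :
    eLpNorm (fun x => w x * v x) q (volume.restrict Ω) ≤
      C * eLpNorm G (ENNReal.ofReal p) (volume.restrict Ω) := by
  obtain ⟨G', hG', hG'p, φ, hφ, hφG, hφv⟩ := hv
  rw [eLpNorm_congr_ae (hG.ae_eq hΩ hG')]
  have hφ1 : ∀ k, ContDiff ℝ 1 (φ k) := fun k => (hφ k).1.of_le (by exact_mod_cast le_top)
  have hp' : 1 ≤ ENNReal.ofReal p := by simpa using hp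
  set B := eLpNorm G' (ENNReal.ofReal p) (volume.restrict Ω) with hB
  have hbound : ∀ k, eLpNorm (fun x => w x * φ k x) q volume ≤
      C * (eLpNorm (fun x => ∇ (φ k) x - G' x) (ENNReal.ofReal p) (volume.restrict Ω) + B) := by
    intro k
    refine (h _ (hφ k)).trans ?_
    gcongr
    have e : ∇ (φ k) = (fun x => ∇ (φ k) x - G' x) + G' := by ext1 x; simp
    conv_lhs => rw [e]
    exact eLpNorm_add_le ((continuous_gradient (hφ1 k)).aestronglyMeasurable.sub hG'p.1) hG'p.1 hp'
  have hlim : Tendsto (fun k => (C : ℝ≥0∞) * (eLpNorm (fun x => ∇ (φ k) x - G' x)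
      (ENNReal.ofReal p) (volume.restrict Ω) + B)) atTop (𝓝 (C * B)) := by
    have h0 := ENNReal.Tendsto.const_mul (hφG.add_const B) (Or.inr (ENNReal.coe_ne_top (r := C)))
    rwa [zero_add] at h0
  have hvK : ∀ K, IsCompact K → K ⊆ Ω → AEStronglyMeasurable v (volume.restrict K) :=
    fun K hK hKΩ => (hG.1.integrableOn_compact_subset hKΩ hK).aestronglyMeasurable
  have hwm : ∀ μ : Measure (EuclideanSpace ℝ (Fin n)), AEStronglyMeasurable w μ :=
    fun μ => hw.aestronglyMeasurable
  have hcompact : ∀ K, IsCompact K → K ⊆ Ω →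
      eLpNorm (fun x => w x * v x) q (volume.restrict K) ≤ C * B := by
    intro K hK hKΩ
    -- L₁ convergence on K yields an a.e. convergent subsequence, and Fatou's lemma passes the bound
    -- to v, also for q = ∞. An exhaustion of Ω by compact sets follows.
    have hmeas := tendstoInMeasure_of_tendsto_eLpNorm_of_ne_top one_ne_zero ENNReal.one_ne_top
      (fun k => (hφ1 k).continuous.aestronglyMeasurable) (hvK K hK hKΩ) (hφv K hK hKΩ)
    obtain ⟨ns, hns, hae⟩ := hmeas.exists_seq_tendsto_ae
    refine le_of_forall_gt_imp_ge_of_dense fun b hb => ?_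
    refine Lp.eLpNorm_le_of_ae_tendsto (u := atTop) (f := fun k x => w x * φ (ns k) x) ?_
      (fun k => (hwm _).mul (hφ1 _).continuous.aestronglyMeasurable)
      (hae.mono fun x hx => hx.const_mul _)
    filter_upwards [(hlim.comp hns.tendsto_atTop).eventually (gt_mem_nhds hb)] with k hk
    exact (eLpNorm_mono_measure _ Measure.restrict_le_self).trans ((hbound _).trans hk.le)
  obtain ⟨F, hFc, hFΩ, hFU, hFm⟩ := hΩ.exists_iUnion_isClosed
  set K : ℕ → Set (EuclideanSpace ℝ (Fin n)) := fun k => F k ∩ Metric.closedBall 0 k with hK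
  have hKc : ∀ k, IsCompact (K k) := fun k => (isCompact_closedBall _ _).inter_left (hFc k)
  have hKΩ : ∀ k, K k ⊆ Ω := fun k => inter_subset_left.trans (hFΩ k)
  rw [← eLpNorm_indicator_eq_eLpNorm_restrict hΩ.measurableSet]
  refine Lp.eLpNorm_le_of_ae_tendsto (u := atTop)
    (f := fun k => (K k).indicator fun x => w x * v x) (Eventually.of_forall fun k => ?_)
    (fun k => ?_) (Eventually.of_forall fun x => ?_)
  · rw [eLpNorm_indicator_eq_eLpNorm_restrict (hKc k).measurableSet]
    exact hcompact _ (hKc k) (hKΩ k)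
  · rw [aestronglyMeasurable_indicator_iff (hKc k).measurableSet]
    exact (hwm _).mul (hvK _ (hKc k) (hKΩ k))
  · by_cases hx : x ∈ Ω
    · refine tendsto_const_nhds.congr' ?_
      rw [← hFU] at hx
      obtain ⟨i, hi⟩ := mem_iUnion.1 hx
      obtain ⟨j, hj⟩ := exists_nat_ge ‖x‖
      filter_upwards [eventually_ge_atTop (max i j)] with k hk
      have hxK : x ∈ K k := by
        refine ⟨hFm ((le_max_left i j).trans hk) hi, ?_⟩
        rw [mem_closedBall_zero_iff]
        exact hj.trans (by exact_mod_cast (le_max_right i j).trans hk)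
      rw [indicator_of_mem hxK, indicator_of_mem (hKΩ k hxK)]
    · refine tendsto_const_nhds.congr fun k => ?_
      rw [indicator_of_notMem hx, indicator_of_notMem fun h => hx (hKΩ k h)]

end Closure

/-! ### Translation to the exponents p and σ, and assembly of the cases -/

theorem eLpNorm_le_of_lintegral_weightedPower_le {m n : ℕ} (h : m ≤ n) {p q σ : ℝ} (hq : 0 < q)
    (hσ : (σ - 1) * q = -(n + q * (1 - n / p))) {φ : EuclideanSpace ℝ (Fin n) → ℝ} {C : ℝ≥0}
    (hC : ∫⁻ x, ENNReal.ofReal (weightedPower (yProj h) n p q φ x) ≤ C) :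
    eLpNorm (fun x => ‖yPart h x‖ ^ (σ - 1) * φ x) (ENNReal.ofReal q) volume ≤
      ((C ^ q⁻¹ : ℝ≥0) : ℝ≥0∞) := by
  have e : ∀ x, weightedPower (yProj h) n p q φ x = ‖‖yPart h x‖ ^ (σ - 1) * φ x‖ ^ q := by
    intro x
    rw [weightedPower, norm_yProj, ← hσ, norm_mul, Real.norm_of_nonneg (by positivity),
      Real.mul_rpow (by positivity) (norm_nonneg _), ← Real.rpow_mul (norm_nonneg _),
      Real.norm_eq_abs]
  simp_rw [e] at hC
  rw [lintegral_ofReal_norm_rpow _ _ hq] at hC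
  rw [ENNReal.coe_rpow_of_nonneg _ (inv_nonneg.2 hq.le)]
  rwa [ENNReal.le_rpow_inv_iff hq]

theorem IsTestFunction.contDiff_one {n : ℕ} {Ω : Set (EuclideanSpace ℝ (Fin n))}
    {φ : EuclideanSpace ℝ (Fin n) → ℝ} (hφ : IsTestFunction Ω φ) : ContDiff ℝ 1 φ :=
  hφ.1.of_le (by exact_mod_cast le_top)

theorem exists_norm_eq_one_inner_eq_zero {m : ℕ} (hm : 2 ≤ m) {e : EuclideanSpace ℝ (Fin m)}
    (he : e ≠ 0) :
    ∃ f : EuclideanSpace ℝ (Fin m), ‖f‖ = 1 ∧ inner ℝ e f = 0 := by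
  have h1 : Module.finrank ℝ (ℝ ∙ e) + Module.finrank ℝ (ℝ ∙ e)ᗮ = m := by
    rw [Submodule.finrank_add_finrank_orthogonal, finrank_euclideanSpace_fin]
  have h2 : Module.finrank ℝ (ℝ ∙ e) = 1 := finrank_span_singleton he
  have : Nontrivial (ℝ ∙ e)ᗮ := Module.nontrivial_of_finrank_pos (R := ℝ) (by omega)
  obtain ⟨f, hf⟩ := exists_norm_eq (ℝ ∙ e)ᗮ zero_le_one
  exact ⟨f, hf, Submodule.mem_orthogonal_singleton_iff_inner_right.1 f.2⟩

/-- The inequality for test functions normalized by their gradient, with a domain that avoids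
a half-space `ℓ × ℝⁿ⁻ᵐ`. -/
theorem exists_lintegral_weightedPower_le_of_ray {m n : ℕ} (hm : 2 ≤ m) (h : m ≤ n)
    {Ω : Set (EuclideanSpace ℝ (Fin n))} {e : EuclideanSpace ℝ (Fin m)} (he : e ≠ 0)
    (hΩ : ∀ x ∈ Ω, yPart h x ∉ ray e) :
    ∃ C : ℝ≥0, ∀ φ : EuclideanSpace ℝ (Fin n) → ℝ, IsTestFunction Ω φ →
      ∫⁻ x, ENNReal.ofReal (‖fderiv ℝ φ x‖ ^ (m : ℝ)) ≤ 1 →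
      ∫⁻ x, ENNReal.ofReal (weightedPower (yProj h) n m m φ x) ≤ C := by
  obtain ⟨f, hf, hef⟩ := exists_norm_eq_one_inner_eq_zero hm he
  have he0 : 0 < ‖e‖ := norm_pos_iff.2 he
  set e₁ : EuclideanSpace ℝ (Fin m) := ‖e‖⁻¹ • e with he₁
  have hne₁ : ‖e₁‖ = 1 := by
    rw [he₁, norm_smul, norm_inv, norm_norm, inv_mul_cancel₀ he0.ne']
  obtain ⟨C, hC⟩ := exists_lintegral_weightedPower_le_of_slit (yProj_yProj h) (inner_yProj_left h)
    (finrank_range_yProj h) (by omega) (e := yInclusion h e₁) (f := yInclusion h f)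
    (by rw [norm_yInclusion, hne₁]) (by rw [norm_yInclusion, hf])
    (by rw [inner_yInclusion_left, yPart_yInclusion, he₁, real_inner_smul_left, hef, mul_zero])
    (by rw [yProj_apply, yPart_yInclusion]) (by rw [yProj_apply, yPart_yInclusion]) n
  refine ⟨C, fun φ hφ h1 => hC φ hφ.contDiff_one hφ.2.1 (fun x hx ht hP => ?_) h1⟩
  -- The ray is parametrized by e, which need not be a unit vector; hence the factor ‖e‖⁻¹.
  refine hΩ x (hφ.2.2 hx) ⟨inner ℝ (yInclusion h e₁) x * ‖e‖⁻¹, by positivity, ?_⟩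
  have := congrArg (yPart h) hP
  rw [yProj_apply, yPart_yInclusion, ← map_smul, yPart_yInclusion] at this
  rw [this, he₁, smul_smul]

/-- The inequality for test functions normalized by their gradient. -/
theorem exists_eLpNorm_mul_le_of_normalized (n m : ℕ) (hm : 2 ≤ m) (hmn : m < n)
    (p σ : ℝ) (hp : 1 ≤ p) (hσ0 : 0 ≤ σ) (hσ1 : σ ≤ min 1 ((n : ℝ) / p))
    (Ω : Set (EuclideanSpace ℝ (Fin n)))
    (hcases :
      ((n : ℝ) * (p - m) / (p * ((n : ℝ) - m)) < σ ∧ σ ≤ 1) ∨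
      (Ω ⊆ (planeP hmn.le)ᶜ ∧ (m : ℝ) < p ∧
        σ ≤ min ((n : ℝ) * (p - m) / (p * ((n : ℝ) - m))) ((n : ℝ) / p) ∧ σ ≠ 1) ∨
      ((∃ e : EuclideanSpace ℝ (Fin m), e ≠ 0 ∧
          ∀ x ∈ Ω, yPart hmn.le x ∉ ray e) ∧
        p = m ∧ σ = 0)) :
    ∃ C : ℝ≥0, ∀ φ : EuclideanSpace ℝ (Fin n) → ℝ, IsTestFunction Ω φ →
      ∫⁻ x, ENNReal.ofReal (‖fderiv ℝ φ x‖ ^ p) ≤ 1 →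
      eLpNorm (fun x => ‖yPart hmn.le x‖ ^ (σ - 1) * φ x) (pStar n p σ) volume ≤ C := by
  have hp0 : 0 < p := by linarith
  have hm2 : (2 : ℝ) ≤ m := by exact_mod_cast hm
  have hmn' : (m : ℝ) < n := by exact_mod_cast hmn
  have hn0 : (0 : ℝ) < n := by linarith
  have hσle : σ ≤ 1 := hσ1.trans (min_le_left _ _)
  have hσp : σ * p ≤ n := by
    rw [← le_div_iff₀ hp0]; exact hσ1.trans (min_le_right _ _)
  have hfin : Module.finrank ℝ (EuclideanSpace ℝ (Fin n)) = n := finrank_euclideanSpace_fin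
  have hplane : Ω ⊆ (planeP hmn.le)ᶜ → ∀ φ, IsTestFunction Ω φ →
      ∀ x ∈ tsupport φ, yProj hmn.le x ≠ 0 := by
    intro hΩP φ hφ x hx h0
    refine hΩP (hφ.2.2 hx) ?_
    change yPart hmn.le x = 0
    rw [← norm_eq_zero, ← norm_yProj, h0, norm_zero]
  rcases hσp.eq_or_lt with hσn | hσn
  · have hb : Ω ⊆ (planeP hmn.le)ᶜ ∧ (n : ℝ) < p := by
      rcases hcases with ⟨ha, ha1⟩ | ⟨hΩP, hmp, -, hσne⟩ | ⟨-, -, h0⟩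
      · rw [div_lt_iff₀ (mul_pos hp0 (by linarith)), ← mul_assoc, hσn] at ha
        have := lt_of_mul_lt_mul_left ha hn0.le
        have := mul_le_of_le_one_left hp0.le hσle
        linarith
      · refine ⟨hΩP, ?_⟩
        have : σ < 1 := lt_of_le_of_ne hσle hσne
        nlinarith
      · rw [h0, zero_mul] at hσn; linarith
    obtain ⟨M, hM⟩ := exists_rpow_mul_abs_le_of_vanishing (yProj_yProj hmn.le) hp
      (by rw [hfin]; exact hb.2)
    rw [hfin] at hM
    have hae := ae_map_ne_zero (finrank_range_yProj hmn.le) (by omega)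
    refine ⟨M, fun φ hφ h1 => ?_⟩
    have hσe : σ - 1 = -(1 - n / p) := by
      rw [← hσn]; field_simp; ring
    rw [pStar, if_pos hσn, eLpNorm_exponent_top, ← ENNReal.ofReal_coe_nnreal]
    refine eLpNormEssSup_le_of_ae_bound (hae.mono fun x hx => ?_)
    have := hM φ hφ.contDiff_one (hplane hb.1 φ hφ) h1 x hx
    rwa [norm_mul, Real.norm_of_nonneg (by positivity), Real.norm_eq_abs, hσe, ← norm_yProj]
  · have hden : 0 < n - σ * p := by linarith
    set q : ℝ := n * p / (n - σ * p) with hq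
    have hq0 : 0 < q := by positivity
    have hpq : p ≤ q := by
      rw [hq, le_div_iff₀ hden]
      nlinarith [mul_nonneg hσ0 (mul_pos hp0 hp0).le]
    have hqp : p < n → q ≤ n * p / (n - p) := by
      intro hpn
      rw [hq]
      have := mul_le_of_le_one_left hp0.le hσle
      gcongr
    have hrel : (σ - 1) * q = -(n + q * (1 - n / p)) := by
      rw [hq]; field_simp; ring
    have hstar : pStar n p σ = ENNReal.ofReal q := by rw [pStar, if_neg hσn.ne]
    suffices ∃ C : ℝ≥0, ∀ φ : EuclideanSpace ℝ (Fin n) → ℝ, IsTestFunction Ω φ →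
        ∫⁻ x, ENNReal.ofReal (‖fderiv ℝ φ x‖ ^ p) ≤ 1 →
        ∫⁻ x, ENNReal.ofReal (weightedPower (yProj hmn.le) n p q φ x) ≤ C by
      obtain ⟨C, hC⟩ := this
      refine ⟨C ^ q⁻¹, fun φ hφ h1 => ?_⟩
      rw [hstar]
      exact eLpNorm_le_of_lintegral_weightedPower_le hmn.le hq0 hrel (hC φ hφ h1)
    rcases hcases with ⟨ha, ha1⟩ | ⟨hΩP, hmp, -, -⟩ | ⟨⟨e, he, hΩe⟩, rfl, rfl⟩
    · rw [div_lt_iff₀ (mul_pos hp0 (by linarith))] at ha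
      have hpn : p < n := by nlinarith
      -- With n + q(1 - n/p) = (1 - σ)q, clearing denominators turns this into the lower bound on σ
      -- in (a).
      have hqm : n + q * (1 - n / p) < m := by
        have : n + q * (1 - n / p) = (1 - σ) * q := by linarith
        rw [this, hq, ← mul_div_assoc, div_lt_iff₀ hden]
        nlinarith
      have := exists_lintegral_weightedPower_le (yProj_yProj hmn.le)
        (finrank_range_yProj hmn.le) (by omega) hp (by rw [hfin]; exact hpn) hpq
        (by rw [hfin]; exact hqp hpn) (by rw [hfin]; exact hqm)
      rw [hfin] at this
      obtain ⟨C, hC⟩ := this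
      exact ⟨C, fun φ hφ h1 => hC φ hφ.contDiff_one hφ.2.1 h1⟩
    · have := exists_lintegral_weightedPower_le_of_vanishing (yProj_yProj hmn.le)
        (norm_yProj_le hmn.le) (finrank_range_yProj hmn.le) (by omega) hmp hpq
        (by rw [hfin]; exact hqp)
      rw [hfin] at this
      obtain ⟨C, hC⟩ := this
      exact ⟨C, fun φ hφ h1 => hC φ hφ.contDiff_one hφ.2.1 (hplane hΩP φ hφ) h1⟩
    · have hqm : q = m := by
        rw [hq, zero_mul, sub_zero]; field_simp
      rw [hqm]
      exact exists_lintegral_weightedPower_le_of_ray hm hmn.le he hΩe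

end MazyaSobolev

theorem proposition1 (n m : ℕ) (hm : 2 ≤ m) (hmn : m < n)
    (p σ : ℝ) (hp : 1 ≤ p) (hσ0 : 0 ≤ σ) (hσ1 : σ ≤ min 1 ((n : ℝ) / p))
    (Ω : Set (EuclideanSpace ℝ (Fin n))) (hΩ : MazyaSobolev.IsDomainSet Ω)
    (hcases :
      -- (a) any domain
      ((n : ℝ) * (p - m) / (p * ((n : ℝ) - m)) < σ ∧ σ ≤ 1) ∨
      -- (b) domains that avoid the plane `y = 0`
      (Ω ⊆ (MazyaSobolev.planeP hmn.le)ᶜ ∧ (m : ℝ) < p ∧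
        σ ≤ min ((n : ℝ) * (p - m) / (p * ((n : ℝ) - m))) ((n : ℝ) / p) ∧ σ ≠ 1) ∨
      -- (c) domains that avoid a half-plane `ℓ × ℝⁿ⁻ᵐ`
      ((∃ e : EuclideanSpace ℝ (Fin m), e ≠ 0 ∧
          ∀ x ∈ Ω, MazyaSobolev.yPart hmn.le x ∉ MazyaSobolev.ray e) ∧
        p = m ∧ σ = 0)) :
    ∃ N : ℝ≥0, ∀ v : EuclideanSpace ℝ (Fin n) → ℝ, MazyaSobolev.MemHomSobolev Ω p v →
      ∀ G : EuclideanSpace ℝ (Fin n) → EuclideanSpace ℝ (Fin n),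
        MazyaSobolev.HasWeakGradient Ω v G →
        eLpNorm (fun x => ‖MazyaSobolev.yPart hmn.le x‖ ^ (σ - 1) * v x)
            (MazyaSobolev.pStar n p σ) (volume.restrict Ω) ≤
          N * eLpNorm G (ENNReal.ofReal p) (volume.restrict Ω) := by
  obtain ⟨C, hC⟩ :=
    MazyaSobolev.exists_eLpNorm_mul_le_of_normalized n m hm hmn p σ hp hσ0 hσ1 Ω hcases
  exact ⟨C, fun v hv G hG => MazyaSobolev.eLpNorm_mul_le_of_forall_isTestFunction hΩ.1
    ((MazyaSobolev.measurable_norm_yPart hmn.le).pow_const _) hp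
    (fun φ hφ => MazyaSobolev.eLpNorm_mul_le_of_normalized hp hC hφ) hv hG⟩
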